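/- For $0<p<\infty$ and $g:\mathbf{R}\to\mathbf{C}$ put $\|g\|_p^*=\int_{-\infty}^{\infty}\frac{|g(x)|^p}{1+x^2}\,dx$, and let $H^p$ be the class of all functions $h$ holomorphic in the open upper half-plane such that $\|h(\cdot+iy)\|_p^*$ is a bounded function of $y>0$. There are absolute constants $C_1,C_2$ such that the following holds for every real-valued function $f\in L^1(\mathbf{R})$. (a) The function $$h(z)=\frac{i}{2\pi}\int_{-\infty}^{\infty}\frac{f(s)}{z-s}\,ds,\qquad \Im z>0,$$ belongs to $H^{1/2}$, has an angular (nontangential) limit $h(x)$ at almost every real $x$, and satisfies $$f(x)=h(x)+\overline{h(x)}\ \text{ for a.e. } x\in\mathbf{R},\qquad h(iy)\to 0\ \text{ as } y\to+\infty. \qquad (*)$$ Moreover $\|h\|_{1/2}^*\le C_1\|f\|_1+C_2$, where the left-hand side is computed with the boundary function $x\mapsto h(x)$, and the same bound holds for $\|h(\cdot+iy)\|_{1/2}^*$ for every $y>0$. (b) If $f$ is the restriction to $\mathbf{R}$ of an entire function, then there is exactly one entire function $h$ whose restriction to the upper half-plane belongs to $H^{1/2}$ and which satisfies $(*)$. In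 the upper half-plane it is given by the integral in (a). -/

import Mathlib

open MeasureTheory Filter Topology
open scoped ENNReal ComplexConjugate

noncomputable section

/-- `‖g‖*_p = ∫ |g(x)|^p / (1 + x²) dx`, as an extended nonnegative real. -/
def starNorm (p : ℝ) (g : ℝ → ℂ) : ℝ≥0∞ :=
  ∫⁻ x : ℝ, ENNReal.ofReal (‖g x‖ ^ p / (1 + x ^ 2))

/-- The Hardy class `H^p`: holomorphic in the open upper half-plane, with `‖h(· + iy)‖*_p`
a bounded function of `y > 0`. Only the values of `h` in the upper half-plane matter. -/
def HardyClass (p : ℝ) (h : ℂ → ℂ) : Prop :=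
  DifferentiableOn ℂ h {z : ℂ | 0 < z.im} ∧
    ∃ M : ℝ, ∀ y : ℝ, 0 < y →
      starNorm p (fun x : ℝ => h ((x : ℂ) + (y : ℂ) * Complex.I)) ≤ ENNReal.ofReal M

/-- `h` has the angular (nontangential) limit `L` at the real point `x`: `h(z) → L` as `z → x`
inside each Stolz angle `|Re z - x| < α Im z` of the upper half-plane. -/
def HasAngularLimit (h : ℂ → ℂ) (x : ℝ) (L : ℂ) : Prop :=
  ∀ α : ℝ, 0 < α → Tendsto h (𝓝[{z : ℂ | 0 < z.im ∧ |z.re - x| < α * z.im}] (x : ℂ)) (𝓝 L)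

/-- The boundary function `hb` consists of the angular limits of `h` (almost everywhere),
`f = hb + conj hb` almost everywhere on the line, and `h(iy) → 0` as `y → +∞`. -/
def Decomposes (f : ℝ → ℝ) (h : ℂ → ℂ) (hb : ℝ → ℂ) : Prop :=
  (∀ᵐ x : ℝ, HasAngularLimit h x (hb x)) ∧
    (∀ᵐ x : ℝ, (f x : ℂ) = hb x + conj (hb x)) ∧
    Tendsto (fun y : ℝ => h ((y : ℂ) * Complex.I)) atTop (𝓝 0)

/-- `z ↦ (i / 2π) ∫ f(s) / (z - s) ds`, for `z` in the upper half-plane. -/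
def cauchyTransform (f : ℝ → ℝ) (z : ℂ) : ℂ :=
  Complex.I / (2 * (Real.pi : ℂ)) * ∫ s : ℝ, (f s : ℂ) / (z - (s : ℂ))

end

/-! The real part of the Cauchy transform of `f` is half its Poisson integral. For `f ≥ 0` the
transform `w` therefore lies in the right half-plane, where `|w|^{1/2} ≤ √2 Re (w + 1)^{1/2}`.
Poisson's formula at `i` integrates the right side against `dx / (1 + x²)` and gives Kolmogorov's
estimate, uniformly in the height `y`. The general case follows from `f = f⁺ - f⁻`.

For boundary values, again with `f ≥ 0`, Fatou's theorem applies to the bounded function `1 / (w +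
1)`. Its limit is nonzero almost everywhere, since otherwise `|w|` would blow up on a set of
positive measure, against the `H^{1/2}` bound. The identity `f = h + conj h` holds because the
Poisson kernel is an approximate identity that contracts `L¹`.

If `f` extends to an entire `F`, write `F(s)/(z - s) = F(z)/(z - s) - (F(z) - F(s))/(z - s)` on
`[-R, R]`. The second term is entire in `z`, and the first integrates to logarithms whose cuts avoid
the strip `|Re z| < R`. These continuations glue to an entire function.

For uniqueness, the difference `d` of two solutions is imaginary on the line, so `|d|` is symmetric
under reflection and the `H^{1/2}` bound holds on almost every horizontal line of the plane. The
approximate sub-mean value property of `|d|^{1/2}` turns this into polynomial growth. Hence `d` is a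
polynomial, and it vanishes because it tends to zero along the imaginary axis
(`eq_zero_of_re_eq_zero`). -/

/-! ### Poisson's formula for bounded holomorphic functions -/

theorem integrable_div_one_add_sq {φ : ℝ → ℂ} (hφ : AEStronglyMeasurable φ) {M : ℝ}
    (hM : ∀ x, ‖φ x‖ ≤ M) : Integrable (fun x : ℝ => φ x / (1 + (x : ℂ) ^ 2)) := by
  have h1 : Integrable (fun x : ℝ => (((1 + x ^ 2)⁻¹ : ℝ) : ℂ)) := integrable_inv_one_add_sq.ofReal
  refine (h1.bdd_mul hφ (c := M) (Eventually.of_forall hM)).congr (Eventually.of_forall fun x => ?_)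
  simp [div_eq_mul_inv]

theorem tendsto_div_sq_sub_one (C : ℝ) :
    Tendsto (fun R : ℝ => C / (R ^ 2 - 1) * (4 * R)) atTop (𝓝 0) := by
  have h2 : Tendsto (fun R : ℝ => R - R⁻¹) atTop atTop :=
    tendsto_atTop_add_right_of_le' atTop (-1 : ℝ) tendsto_id (by
      filter_upwards [eventually_ge_atTop (1 : ℝ)] with R hR
      have := inv_le_one_of_one_le₀ hR
      linarith)
  have h3 := (h2.const_div_atTop (4 * C))
  refine h3.congr' ?_
  filter_upwards [eventually_gt_atTop (1 : ℝ)] with R hR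
  have h5 : R ^ 2 - 1 ≠ 0 := by nlinarith
  have h6 : R ≠ 0 := by linarith
  have h7 : R - R⁻¹ = (R ^ 2 - 1) / R := by field_simp
  rw [h7]
  field_simp

/-- Poisson's formula at the point `i` of the upper half-plane. -/
theorem integral_div_one_add_sq_eq {Φ : ℂ → ℂ} (hc : ContinuousOn Φ {z | 0 ≤ z.im})
    (hd : DifferentiableOn ℂ Φ {z | 0 < z.im}) {M : ℝ} (hM : ∀ z : ℂ, 0 ≤ z.im → ‖Φ z‖ ≤ M) :
    ∫ x : ℝ, Φ x / (1 + (x : ℂ) ^ 2) = Real.pi * Φ Complex.I := by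
  have hopen : IsOpen {z : ℂ | 0 < z.im} := isOpen_lt continuous_const Complex.continuous_im
  have hI : {z : ℂ | 0 < z.im} ∈ 𝓝 Complex.I := hopen.mem_nhds (by simp)
  have hI' : {z : ℂ | 0 ≤ z.im} ∈ 𝓝 Complex.I := mem_of_superset hI fun z (hz : 0 < z.im) => hz.le
  have hne : ∀ z : ℂ, 0 ≤ z.im → z + Complex.I ≠ 0 := by
    intro z hz h
    have := congrArg Complex.im h
    simp at this
    linarith
  -- This is `(Φ z - Φ i) / (1 + z²)` with its singularity at `i` removed. Its integral around the
  -- rectangle `[-R, R] × [0, R]` vanishes, and the three sides off the real axis have total length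
  -- `4R` while `D = O(R⁻²)` there.
  set D : ℂ → ℂ := fun z => dslope Φ Complex.I z / (z + Complex.I) with hD
  have hDc : ContinuousOn D {z | 0 ≤ z.im} := by
    refine ContinuousOn.div ?_ (by fun_prop) hne
    exact (continuousOn_dslope hI').2 ⟨hc, (hd.differentiableAt hI)⟩
  have hDd : DifferentiableOn ℂ D {z | 0 < z.im} := by
    refine DifferentiableOn.div ?_ (by fun_prop) (fun z hz => hne z (le_of_lt hz))
    exact (Complex.differentiableOn_dslope hI).2 hd
  have hDval : ∀ z : ℂ, 0 ≤ z.im → z ≠ Complex.I →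
      D z = (Φ z - Φ Complex.I) / (1 + z ^ 2) := by
    intro z hz hzI
    have h1 : z - Complex.I ≠ 0 := sub_ne_zero.2 hzI
    have h2 := hne z hz
    have h3 : (1 + z ^ 2) = (z - Complex.I) * (z + Complex.I) := by
      ring_nf; simp; ring
    rw [h3, hD]
    simp only [dslope_of_ne _ hzI, slope_def_field]
    field_simp
  have hDbd : ∀ R : ℝ, 1 < R → ∀ z : ℂ, 0 ≤ z.im → R ≤ ‖z‖ → ‖D z‖ ≤ 2 * M / (R ^ 2 - 1) := by
    intro R hR z hz hRz
    have hzI : z ≠ Complex.I := by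
      rintro rfl
      simp at hRz
      linarith
    rw [hDval z hz hzI, norm_div]
    have h1 : ‖Φ z - Φ Complex.I‖ ≤ 2 * M :=
      (norm_sub_le _ _).trans (by linarith [hM z hz, hM Complex.I (by simp)])
    have h2 : R ^ 2 - 1 ≤ ‖1 + z ^ 2‖ := by
      have := norm_sub_norm_le (z ^ 2) (-1)
      simp only [norm_pow, norm_neg, norm_one, sub_neg_eq_add] at this
      rw [add_comm 1]
      nlinarith
    have h3 : 0 < R ^ 2 - 1 := by nlinarith
    exact div_le_div₀ (by linarith [norm_nonneg (Φ z - Φ Complex.I)]) h1 h3 h2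
  have hΦm : AEStronglyMeasurable (fun x : ℝ => Φ x) := by
    have : Continuous (fun x : ℝ => Φ x) :=
      hc.comp_continuous Complex.continuous_ofReal (fun x => by simp)
    exact this.aestronglyMeasurable
  have hreal : ∀ x : ℝ, (x : ℂ) ≠ Complex.I := by
    intro x h
    have := congrArg Complex.im h
    simp at this
  have hDx : ∀ x : ℝ, D x = Φ x / (1 + (x : ℂ) ^ 2) - Φ Complex.I / (1 + (x : ℂ) ^ 2) := by
    intro x
    rw [hDval x (by simp) (hreal x), sub_div]
  have i1 := integrable_div_one_add_sq hΦm (fun x => hM x (by simp))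
  have i2 := integrable_div_one_add_sq (φ := fun _ => Φ Complex.I) (M := ‖Φ Complex.I‖)
    aestronglyMeasurable_const (fun x => le_rfl)
  have iD : Integrable (fun x : ℝ => D x) := (i1.sub i2).congr (Eventually.of_forall fun x => (hDx x).symm)
  have hlim := intervalIntegral_tendsto_integral iD tendsto_neg_atTop_atBot tendsto_id
  have hzero : Tendsto (fun R : ℝ => ∫ x in (-R)..R, D x) atTop (𝓝 0) := by
    refine squeeze_zero_norm' ?_ (tendsto_div_sq_sub_one (2 * M))
    filter_upwards [eventually_gt_atTop (1 : ℝ)] with R hR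
    have hrect := Complex.integral_boundary_rect_eq_zero_of_continuousOn_of_differentiableOn D
      (-R : ℂ) (R + R * Complex.I)
      (hDc.mono (by
        intro z hz
        have h := hz.2
        simp [Set.uIcc_of_le (show (0 : ℝ) ≤ R by linarith)] at h
        exact h.1))
      (hDd.mono (by
        intro z hz
        have h := hz.2
        simp [min_eq_left (show (0 : ℝ) ≤ R by linarith)] at h
        exact h.1))
    simp only [Complex.neg_re, Complex.ofReal_re, Complex.add_re, Complex.mul_re, Complex.I_re,
      mul_zero, Complex.ofReal_im, Complex.I_im, mul_one, sub_self, add_zero, Complex.neg_im,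
      neg_zero, Complex.ofReal_zero, zero_mul, Complex.add_im, Complex.mul_im, zero_add] at hrect
    have hR0 : 0 ≤ R := by linarith
    have b1 : ‖∫ x in (-R)..R, D (x + R * Complex.I)‖ ≤ 2 * M / (R ^ 2 - 1) * |R - (-R)| := by
      refine intervalIntegral.norm_integral_le_of_norm_le_const fun x _ => hDbd R hR _ (by simpa) ?_
      refine le_trans ?_ (Complex.abs_im_le_norm _)
      simp [le_abs_self]
    have b2 : ‖∫ y in (0 : ℝ)..R, D (R + y * Complex.I)‖ ≤ 2 * M / (R ^ 2 - 1) * |R - 0| := by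
      refine intervalIntegral.norm_integral_le_of_norm_le_const fun y hy => hDbd R hR _ ?_ ?_
      · rw [Set.uIoc_of_le hR0] at hy
        simpa using hy.1.le
      · refine le_trans ?_ (Complex.abs_re_le_norm _)
        simp [le_abs_self]
    have b3 : ‖∫ y in (0 : ℝ)..R, D ((-R : ℝ) + y * Complex.I)‖ ≤
        2 * M / (R ^ 2 - 1) * |R - 0| := by
      refine intervalIntegral.norm_integral_le_of_norm_le_const fun y hy => hDbd R hR _ ?_ ?_
      · rw [Set.uIoc_of_le hR0] at hy
        simpa using hy.1.le
      · refine le_trans ?_ (Complex.abs_re_le_norm _)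
        simp [le_abs_self]
    have e : ∫ x in (-R)..R, D x = (∫ x in (-R)..R, D (x + R * Complex.I)) -
        Complex.I • (∫ y in (0 : ℝ)..R, D (R + y * Complex.I)) +
        Complex.I • (∫ y in (0 : ℝ)..R, D ((-R : ℝ) + y * Complex.I)) := by
      linear_combination hrect
    rw [e]
    refine (norm_add_le _ _).trans ?_
    refine (add_le_add_left (norm_sub_le _ _) _).trans ?_
    rw [norm_smul, norm_smul, Complex.norm_I, one_mul, one_mul]
    have e1 : |R - (-R)| = 2 * R := by rw [abs_of_nonneg] <;> linarith
    have e2 : |R - 0| = R := by rw [abs_of_nonneg] <;> linarith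
    rw [e1] at b1
    rw [e2] at b2 b3
    linarith
  have h0 : ∫ x : ℝ, D x = 0 := tendsto_nhds_unique hlim hzero
  rw [integral_congr_ae (Eventually.of_forall hDx), integral_sub i1 i2, sub_eq_zero] at h0
  rw [h0]
  have e3 : ∀ x : ℝ, Φ Complex.I / (1 + (x : ℂ) ^ 2) = (((1 + x ^ 2)⁻¹ : ℝ) : ℂ) * Φ Complex.I := by
    intro x
    push_cast
    rw [div_eq_mul_inv, mul_comm]
  simp_rw [e3]
  rw [integral_mul_const, integral_complex_ofReal, integral_univ_inv_one_add_sq]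

/-- Poisson's formula at an arbitrary point of the upper half-plane. -/
theorem integral_comp_affine_div_one_add_sq_eq {Φ : ℂ → ℂ} (hc : ContinuousOn Φ {z | 0 ≤ z.im})
    (hd : DifferentiableOn ℂ Φ {z | 0 < z.im}) {M : ℝ} (hM : ∀ z : ℂ, 0 ≤ z.im → ‖Φ z‖ ≤ M)
    {z : ℂ} (hz : 0 < z.im) :
    ∫ t : ℝ, Φ ((z.re + z.im * t : ℝ) : ℂ) / (1 + (t : ℂ) ^ 2) = Real.pi * Φ z := by
  have him : ∀ w : ℂ, ((z.re : ℂ) + z.im * w).im = z.im * w.im := by intro w; simp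
  have h := integral_div_one_add_sq_eq (Φ := fun w => Φ (z.re + z.im * w)) (M := M)
    (hc.comp (by fun_prop) (fun w hw => by
      simp only [Set.mem_ofPred_eq, him] at hw ⊢; positivity))
    (hd.comp (by fun_prop) (fun w hw => by
      simp only [Set.mem_ofPred_eq, him] at hw ⊢; positivity))
    (fun w hw => hM _ (by rw [him]; positivity))
  rw [Complex.re_add_im] at h
  rw [← h]
  push_cast
  rfl

/-! ### Fatou's theorem, from differentiability almost everywhere of a Lipschitz primitive -/

theorem isOpen_upperHalfPlaneSet : IsOpen {z : ℂ | 0 < z.im} :=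
  isOpen_lt continuous_const Complex.continuous_im

/-- The Cayley map `ψ` moves the problem to the unit disc, where primitives exist; the factor `2i /
(1 - w)²` is `ψ'`. -/
theorem exists_hasDerivAt_of_differentiableOn_upperHalfPlane {G : ℂ → ℂ}
    (hG : DifferentiableOn ℂ G {z | 0 < z.im}) :
    ∃ K : ℂ → ℂ, ∀ z : ℂ, 0 < z.im → HasDerivAt K (G z) z := by
  set ψ : ℂ → ℂ := fun w => Complex.I * (1 + w) / (1 - w) with hψ
  have hne : ∀ w ∈ Metric.ball (0 : ℂ) 1, 1 - w ≠ 0 := by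
    intro w hw h
    rw [← sub_eq_zero.1 h] at hw
    simp at hw
  have hψim : ∀ w ∈ Metric.ball (0 : ℂ) 1, 0 < (ψ w).im := by
    intro w hw
    have h1 : 0 < Complex.normSq (1 - w) := Complex.normSq_pos.2 (hne w hw)
    have h2 : ‖w‖ ^ 2 < 1 := by
      have : ‖w‖ < 1 := by simpa using hw
      nlinarith [norm_nonneg w]
    rw [Complex.sq_norm, Complex.normSq_apply] at h2
    have h3 : (ψ w).im = (1 - (w.re * w.re + w.im * w.im)) / Complex.normSq (1 - w) := by
      simp only [hψ, Complex.div_im]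
      simp
      field_simp
      ring
    rw [h3]
    exact div_pos (by linarith) h1
  have hd : DifferentiableOn ℂ (fun w => G (ψ w) * (2 * Complex.I / (1 - w) ^ 2))
      (Metric.ball 0 1) := by
    refine DifferentiableOn.mul (hG.comp ?_ hψim) ?_
    · exact DifferentiableOn.div (by fun_prop) (by fun_prop) hne
    · exact DifferentiableOn.div (by fun_prop) (by fun_prop) fun w hw => pow_ne_zero 2 (hne w hw)
  obtain ⟨A, hA⟩ := hd.isExactOn_ball
  refine ⟨fun z => A ((z - Complex.I) / (z + Complex.I)), fun z hz => ?_⟩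
  have hzI : z + Complex.I ≠ 0 := by
    intro h
    have := congrArg Complex.im h
    simp at this
    linarith
  have hmem : (z - Complex.I) / (z + Complex.I) ∈ Metric.ball (0 : ℂ) 1 := by
    rw [mem_ball_zero_iff, norm_div, div_lt_one (norm_pos_iff.2 hzI)]
    refine lt_of_pow_lt_pow_left₀ 2 (norm_nonneg _) ?_
    rw [Complex.sq_norm, Complex.sq_norm, Complex.normSq_apply, Complex.normSq_apply]
    simp
    nlinarith
  have h1 : 1 - (z - Complex.I) / (z + Complex.I) = 2 * Complex.I / (z + Complex.I) := by
    field_simp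
    ring
  have h2 : ψ ((z - Complex.I) / (z + Complex.I)) = z := by
    simp only [hψ, h1]
    field_simp
    ring
  have h3 : HasDerivAt (fun z => (z - Complex.I) / (z + Complex.I))
      (2 * Complex.I / (z + Complex.I) ^ 2) z := by
    convert! ((hasDerivAt_id z).sub_const Complex.I).div ((hasDerivAt_id z).add_const Complex.I)
      hzI using 1
    simp
    ring
  have h4 := (hA _ hmem).comp z h3
  simp only [h2, h1] at h4
  convert! h4 using 1
  have hI4 : Complex.I ^ 2 = -1 := Complex.I_sq
  field_simp

/-- A bounded derivative on a convex set gives a Lipschitz primitive, which extends past the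
boundary. On the real line the extension is differentiable almost everywhere. -/
theorem exists_lipschitzWith_primitive {G : ℂ → ℂ} (hG : DifferentiableOn ℂ G {z | 0 < z.im})
    {M : ℝ} (hM : ∀ z : ℂ, 0 < z.im → ‖G z‖ ≤ M) :
    ∃ (K : ℂ → ℂ) (C : NNReal), LipschitzWith C K ∧
      ∀ z : ℂ, 0 < z.im → HasDerivAt K (G z) z := by
  obtain ⟨K₀, hK₀⟩ := exists_hasDerivAt_of_differentiableOn_upperHalfPlane hG
  have hconv : Convex ℝ {z : ℂ | 0 < z.im} := convex_halfSpace_im_gt 0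
  have hlip : LipschitzOnWith M.toNNReal K₀ {z : ℂ | 0 < z.im} := by
    refine hconv.lipschitzOnWith_of_nnnorm_hasDerivWithin_le (f' := G)
      (fun z hz => (hK₀ z hz).hasDerivWithinAt) (fun z hz => ?_)
    rw [← NNReal.coe_le_coe, coe_nnnorm]
    exact (hM z hz).trans (Real.le_coe_toNNReal M)
  obtain ⟨K, hK, heq⟩ := hlip.extend_finite_dimension
  refine ⟨K, _, hK, fun z hz => (hK₀ z hz).congr_of_eventuallyEq ?_⟩
  filter_upwards [isOpen_upperHalfPlaneSet.mem_nhds hz] with w hw using (heq hw).symm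

/-- The quotient `L w / w` is bounded but perhaps not continuous at `0`. Poisson's formula is
applied to `L w / (w + iη)`, whose modulus on the line is at most that of `L s / s`, and then `η →
0`. -/
theorem norm_div_norm_le_integral {L : ℂ → ℂ} {C : NNReal} (hL : LipschitzWith C L)
    (hd : DifferentiableOn ℂ L {z | 0 < z.im}) (h0 : L 0 = 0) {z : ℂ} (hz : 0 < z.im) :
    ‖L z‖ / ‖z‖ ≤ Real.pi⁻¹ * ∫ t : ℝ, ‖L ((z.re + z.im * t : ℝ) : ℂ)‖ / |z.re + z.im * t| *
      (1 + t ^ 2)⁻¹ := by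
  have hLb : ∀ w : ℂ, ‖L w‖ ≤ C * ‖w‖ := by
    intro w
    simpa [h0] using hL.dist_le_mul w 0
  have hqb : ∀ s : ℝ, ‖L s‖ / |s| ≤ C := by
    intro s
    refine div_le_of_le_mul₀ (abs_nonneg _) C.2 ?_
    simpa using hLb s
  have hLc := hL.continuous
  have hq_int : Integrable (fun t : ℝ => ‖L ((z.re + z.im * t : ℝ) : ℂ)‖ / |z.re + z.im * t| *
      (1 + t ^ 2)⁻¹) := by
    refine integrable_inv_one_add_sq.bdd_mul (c := C) ?_ (Eventually.of_forall fun t => ?_)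
    · refine Measurable.aestronglyMeasurable (Measurable.div ?_ ?_)
      · exact (by fun_prop : Continuous fun t : ℝ => ‖L ((z.re + z.im * t : ℝ) : ℂ)‖).measurable
      · fun_prop
    · rw [Real.norm_of_nonneg (by positivity)]
      exact hqb _
  have key : ∀ η : ℝ, 0 < η → ‖L z‖ / ‖z + η * Complex.I‖ ≤ Real.pi⁻¹ *
      ∫ t : ℝ, ‖L ((z.re + z.im * t : ℝ) : ℂ)‖ / |z.re + z.im * t| * (1 + t ^ 2)⁻¹ := by
    intro η hη
    have hne : ∀ w : ℂ, 0 ≤ w.im → w + η * Complex.I ≠ 0 := by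
      intro w hw h
      have := congrArg Complex.im h
      simp at this
      linarith
    have hle : ∀ w : ℂ, 0 ≤ w.im → ‖w‖ ≤ ‖w + η * Complex.I‖ := by
      intro w hw
      refine (pow_le_pow_iff_left₀ (norm_nonneg _) (norm_nonneg _) two_ne_zero).1 ?_
      rw [Complex.sq_norm, Complex.sq_norm, Complex.normSq_apply, Complex.normSq_apply]
      simp
      nlinarith
    have hbd : ∀ w : ℂ, 0 ≤ w.im → ‖L w / (w + η * Complex.I)‖ ≤ C := by
      intro w hw
      rw [norm_div]
      refine div_le_of_le_mul₀ (norm_nonneg _) C.2 ((hLb w).trans ?_)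
      exact mul_le_mul_of_nonneg_left (hle w hw) C.2
    have hP := integral_comp_affine_div_one_add_sq_eq (Φ := fun w => L w / (w + η * Complex.I))
      (ContinuousOn.div hLc.continuousOn (by fun_prop) hne)
      (DifferentiableOn.div hd (by fun_prop) fun w hw => hne w (le_of_lt hw)) hbd hz
    have h1 : Real.pi * (‖L z‖ / ‖z + η * Complex.I‖) ≤
        ∫ t : ℝ, ‖L ((z.re + z.im * t : ℝ) : ℂ)‖ / |z.re + z.im * t| * (1 + t ^ 2)⁻¹ := by
      have h2 := congrArg norm hP
      rw [norm_mul, norm_div, Complex.norm_real, Real.norm_of_nonneg Real.pi_pos.le] at h2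
      rw [← h2]
      refine norm_integral_le_of_norm_le hq_int (Eventually.of_forall fun t => ?_)
      have h3 : ‖(1 + (t : ℂ) ^ 2)‖ = 1 + t ^ 2 := by
        rw [show (1 + (t : ℂ) ^ 2) = ((1 + t ^ 2 : ℝ) : ℂ) by push_cast; rfl, Complex.norm_real,
          Real.norm_of_nonneg (by positivity)]
      rw [norm_div, h3, div_eq_mul_inv, norm_div]
      refine mul_le_mul_of_nonneg_right ?_ (by positivity)
      set s : ℝ := z.re + z.im * t
      rcases eq_or_ne s 0 with hs | hs
      · simp [hs, h0]
      · have := hle (s : ℂ) (by simp)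
        rw [Complex.norm_real, Real.norm_eq_abs] at this
        exact div_le_div_of_nonneg_left (norm_nonneg _) (abs_pos.2 hs) this
    rw [inv_mul_eq_div, le_div_iff₀ Real.pi_pos, mul_comm]
    exact h1
  have hz0 : z ≠ 0 := by
    rintro rfl
    simp at hz
  have hlim : Tendsto (fun η : ℝ => ‖L z‖ / ‖z + η * Complex.I‖) (𝓝[>] 0) (𝓝 (‖L z‖ / ‖z‖)) := by
    have hc : ContinuousAt (fun η : ℝ => ‖L z‖ / ‖z + η * Complex.I‖) 0 :=
      ContinuousAt.div (by fun_prop) (by fun_prop) (by simpa using hz0)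
    have := hc.tendsto
    simp only [Complex.ofReal_zero, zero_mul, add_zero] at this
    exact this.mono_left nhdsWithin_le_nhds
  exact le_of_tendsto hlim (by filter_upwards [self_mem_nhdsWithin] with η hη using key η hη)

/-- Dominated convergence in the Poisson majorant: smallness along the line spreads to the
half-plane, with no restriction to an angle. -/
theorem tendsto_norm_div_norm_upperHalfPlane {L : ℂ → ℂ} {C : NNReal} (hL : LipschitzWith C L)
    (hd : DifferentiableOn ℂ L {z | 0 < z.im}) (h0 : L 0 = 0)
    (hlim : Tendsto (fun s : ℝ => ‖L s‖ / |s|) (𝓝 0) (𝓝 0)) :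
    Tendsto (fun z : ℂ => ‖L z‖ / ‖z‖) (𝓝[{z : ℂ | 0 < z.im}] 0) (𝓝 0) := by
  have hint : Tendsto (fun z : ℂ => ∫ t : ℝ, ‖L ((z.re + z.im * t : ℝ) : ℂ)‖ /
      |z.re + z.im * t| * (1 + t ^ 2)⁻¹) (𝓝[{z : ℂ | 0 < z.im}] 0) (𝓝 (∫ _ : ℝ, (0 : ℝ))) := by
    have hLc := hL.continuous
    refine tendsto_integral_filter_of_dominated_convergence (fun t => C * (1 + t ^ 2)⁻¹)
      (Eventually.of_forall fun z => ?_) (Eventually.of_forall fun z => Eventually.of_forall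
        fun t => ?_) (integrable_inv_one_add_sq.const_mul _) (Eventually.of_forall fun t => ?_)
    · refine Measurable.aestronglyMeasurable (Measurable.mul (Measurable.div ?_ ?_) (by fun_prop))
      · exact (by fun_prop : Continuous fun t : ℝ => ‖L ((z.re + z.im * t : ℝ) : ℂ)‖).measurable
      · fun_prop
    · rw [Real.norm_of_nonneg (by positivity)]
      refine mul_le_mul_of_nonneg_right ?_ (by positivity)
      refine div_le_of_le_mul₀ (abs_nonneg _) C.2 ?_
      simpa only [h0, dist_zero_right, Complex.norm_real, Real.norm_eq_abs] using
        hL.dist_le_mul ((z.re + z.im * t : ℝ) : ℂ) 0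
    · have h1 : Tendsto (fun z : ℂ => z.re + z.im * t) (𝓝[{z : ℂ | 0 < z.im}] 0) (𝓝 0) := by
        have : Continuous (fun z : ℂ => z.re + z.im * t) := by fun_prop
        have := this.tendsto 0
        simp only [Complex.zero_re, Complex.zero_im, zero_mul, add_zero] at this
        exact this.mono_left nhdsWithin_le_nhds
      simpa using (hlim.comp h1).mul_const ((1 + t ^ 2)⁻¹)
  have h2 := hint.const_mul Real.pi⁻¹
  rw [integral_zero, mul_zero] at h2
  refine squeeze_zero' (Eventually.of_forall fun z => by positivity) ?_ h2
  filter_upwards [self_mem_nhdsWithin] with z hz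
  exact norm_div_norm_le_integral hL hd h0 hz

/-- The remainder `K(x + z) - K(x) - cz` is `o(z)` in the half-plane. Cauchy's estimate on a disc of
radius `Im z / 2`, comparable to `|z|` in a Stolz angle, makes its derivative `G - c` tend to zero.
-/
theorem hasAngularLimit_of_hasDerivAt_boundary {K G : ℂ → ℂ} {C : NNReal}
    (hK : LipschitzWith C K) (hG : ∀ z : ℂ, 0 < z.im → HasDerivAt K (G z) z) {x : ℝ} {c : ℂ}
    (hx : HasDerivAt (fun s : ℝ => K s) c x) : HasAngularLimit G x c := by
  set L : ℂ → ℂ := fun z => K (x + z) - K x - c * z with hLdef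
  have hL : LipschitzWith (C * 1 + 0 + ‖c‖₊) L := by
    refine LipschitzWith.sub (LipschitzWith.sub (hK.comp ?_) (LipschitzWith.const _)) ?_
    · exact LipschitzWith.of_dist_le_mul fun a b => by simp
    · exact LipschitzWith.of_dist_le_mul fun a b => by
        simp [dist_eq_norm, ← mul_sub]
  have hLd : ∀ z : ℂ, 0 < z.im → HasDerivAt L (G (x + z) - c) z := by
    intro z hz
    have h1 := (hG (x + z) (by simpa using hz)).comp_const_add (x : ℂ) z
    convert! (h1.sub_const (K x)).sub ((hasDerivAt_id z).const_mul c) using 1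
    simp
  have h0 : L 0 = 0 := by simp [hLdef]
  have hlim : Tendsto (fun s : ℝ => ‖L s‖ / |s|) (𝓝 0) (𝓝 0) := by
    have h1 := (hasDerivAt_iff_isLittleO_nhds_zero.1 hx).norm_norm.tendsto_div_nhds_zero
    refine h1.congr fun s => ?_
    simp [hLdef, mul_comm]
  have ht := tendsto_norm_div_norm_upperHalfPlane hL
    (fun z hz => (hLd z hz).differentiableAt.differentiableWithinAt) h0 hlim
  intro α hα
  rw [Metric.tendsto_nhdsWithin_nhds]
  intro ε hε
  -- On the circle of radius `Im z / 2` one has `|ζ| ≤ 2|z| ≤ 2(1 + α) Im z`, so this constant makes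
  -- Cauchy's bound equal to `ε / 2`.
  have hε' : 0 < ε / (8 * (1 + α)) := by positivity
  obtain ⟨δ, hδ, hδ'⟩ := Metric.tendsto_nhdsWithin_nhds.1 ht _ hε'
  refine ⟨δ / 2, by positivity, fun {w} hw hwδ => ?_⟩
  obtain ⟨hw1, hw2⟩ := hw
  set z : ℂ := w - x with hz
  have hwz : w = x + z := by rw [hz]; ring
  have hzim : z.im = w.im := by simp [hz]
  have hzre : z.re = w.re - x := by simp [hz]
  rw [← hzim] at hw1 hw2
  rw [← hzre] at hw2
  rw [dist_eq_norm, ← hz] at hwδ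
  have hzn : ‖z‖ ≤ (1 + α) * z.im := by
    have := Complex.norm_le_abs_re_add_abs_im z
    rw [abs_of_pos hw1] at this
    linarith
  have him : z.im ≤ ‖z‖ := (le_abs_self _).trans (Complex.abs_im_le_norm z)
  have hball : ∀ ζ ∈ Metric.closedBall z (z.im / 2), 0 < ζ.im := by
    intro ζ hζ
    have h1 : |(ζ - z).im| ≤ z.im / 2 := (Complex.abs_im_le_norm _).trans (by
      rwa [mem_closedBall_iff_norm] at hζ)
    rw [Complex.sub_im] at h1
    linarith [(abs_le.1 h1).1]
  have hcauchy := Complex.norm_deriv_le_of_forall_mem_sphere_norm_le (f := L) (c := z)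
    (R := z.im / 2) (C := ε / (8 * (1 + α)) * (2 * ((1 + α) * z.im))) (by positivity)
    (DifferentiableOn.diffContOnCl_ball (U := {z : ℂ | 0 < z.im})
      (fun ζ hζ => (hLd ζ hζ).differentiableAt.differentiableWithinAt) hball)
    (by
      intro ζ hζ
      have hζim := hball ζ (Metric.sphere_subset_closedBall hζ)
      have hζn : ‖ζ‖ ≤ 2 * ‖z‖ := by
        have h1 : ‖ζ - z‖ = z.im / 2 := by rwa [mem_sphere_iff_norm] at hζ
        have h2 := norm_add_le (ζ - z) z
        rw [sub_add_cancel] at h2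
        linarith [norm_nonneg z]
      have h2 := hδ' (x := ζ) hζim (by rw [dist_zero_right]; linarith)
      have hζ0 : 0 < ‖ζ‖ := by
        rw [norm_pos_iff]
        rintro rfl
        simp at hζim
      rw [dist_zero_right, Real.norm_of_nonneg (by positivity), div_lt_iff₀ hζ0] at h2
      refine h2.le.trans (mul_le_mul_of_nonneg_left ?_ hε'.le)
      linarith)
  rw [(hLd z hw1).deriv] at hcauchy
  rw [hwz, dist_eq_norm]
  refine hcauchy.trans_lt ?_
  have : ε / (8 * (1 + α)) * (2 * ((1 + α) * z.im)) / (z.im / 2) = ε / 2 := by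
    field_simp
    ring
  linarith

/-- Fatou's theorem: a bounded holomorphic function on the upper half-plane has angular limits
at almost every real point. -/
theorem ae_exists_hasAngularLimit_of_bounded {G : ℂ → ℂ}
    (hG : DifferentiableOn ℂ G {z | 0 < z.im}) {M : ℝ} (hM : ∀ z : ℂ, 0 < z.im → ‖G z‖ ≤ M) :
    ∀ᵐ x : ℝ, ∃ c : ℂ, HasAngularLimit G x c := by
  obtain ⟨K, C, hK, hKG⟩ := exists_lipschitzWith_primitive hG hM
  have hK' : LipschitzWith (C * 1) (fun s : ℝ => K s) :=
    hK.comp (LipschitzWith.of_dist_le_mul fun a b => by simp [Complex.dist_eq, Real.dist_eq,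
      ← Complex.ofReal_sub])
  filter_upwards [hK'.ae_differentiableAt_real] with x hx
  exact ⟨_, hasAngularLimit_of_hasDerivAt_boundary hK hKG hx.hasDerivAt⟩

/-! ### Elementary properties of the Cauchy transform -/

/-- Separation is asked only from points where `g ≠ 0`, so that the lemma serves both the upper
half-plane and, for `f` cut off outside `[-R, R]`, the strip `|Re z| < R`. -/
theorem differentiableAt_integral_div_sub {g : ℝ → ℂ} (hg : Integrable g) {z₀ : ℂ} {δ : ℝ}
    (hδ : 0 < δ) (hsep : ∀ s : ℝ, g s ≠ 0 → ∀ z ∈ Metric.ball z₀ δ, δ ≤ ‖z - s‖) :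
    DifferentiableAt ℂ (fun z : ℂ => ∫ s : ℝ, g s / (z - s)) z₀ := by
  have hmeas : ∀ z : ℂ, AEStronglyMeasurable (fun s : ℝ => g s / (z - s)) := by
    intro z
    have h1 : Measurable (fun s : ℝ => (z - (s : ℂ))⁻¹) := by fun_prop
    simp only [div_eq_mul_inv]
    exact hg.aestronglyMeasurable.mul h1.aestronglyMeasurable
  have hmeas' : AEStronglyMeasurable (fun s : ℝ => -g s / (z₀ - s) ^ 2) := by
    have h1 : Measurable (fun s : ℝ => ((z₀ - (s : ℂ)) ^ 2)⁻¹) := by fun_prop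
    simp only [div_eq_mul_inv]
    exact hg.aestronglyMeasurable.neg.mul h1.aestronglyMeasurable
  have hint : Integrable (fun s : ℝ => g s / (z₀ - s)) := by
    refine Integrable.mono' (hg.norm.div_const δ) (hmeas z₀) (Eventually.of_forall fun s => ?_)
    by_cases hs : g s = 0
    · simp [hs]
    · rw [norm_div]
      exact div_le_div_of_nonneg_left (norm_nonneg _) hδ (hsep s hs z₀ (Metric.mem_ball_self hδ))
  refine (hasDerivAt_integral_of_dominated_loc_of_deriv_le (F' := fun z s => -g s / (z - s) ^ 2)
    (bound := fun s => ‖g s‖ / δ ^ 2) (Metric.ball_mem_nhds z₀ hδ) (Eventually.of_forall hmeas)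
    hint hmeas' (Eventually.of_forall fun s z hz => ?_) (hg.norm.div_const _)
    (Eventually.of_forall fun s z hz => ?_)).2.differentiableAt
  · by_cases hs : g s = 0
    · simp [hs]
    · rw [norm_div, norm_neg, norm_pow]
      exact div_le_div_of_nonneg_left (norm_nonneg _) (by positivity)
        (pow_le_pow_left₀ hδ.le (hsep s hs z hz) 2)
  · by_cases hs : g s = 0
    · simpa [hs] using hasDerivAt_const z (0 : ℂ)
    · have h1 : z - s ≠ 0 := norm_pos_iff.1 (hδ.trans_le (hsep s hs z hz))
      have h2 := ((hasDerivAt_id z).sub_const (s : ℂ)).inv h1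
      convert! h2.const_mul (g s) using 1
      simp
      ring

theorem im_le_norm_sub (z : ℂ) (s : ℝ) : z.im ≤ ‖z - s‖ := by
  simpa using (le_abs_self _).trans (Complex.abs_im_le_norm (z - s))

theorem differentiableOn_cauchyTransform {f : ℝ → ℝ} (hf : Integrable f) :
    DifferentiableOn ℂ (cauchyTransform f) {z | 0 < z.im} := by
  intro z (hz : 0 < z.im)
  refine DifferentiableAt.differentiableWithinAt (DifferentiableAt.const_mul ?_ _)
  refine differentiableAt_integral_div_sub (g := fun s => (f s : ℂ)) hf.ofReal
    (δ := z.im / 2) (by positivity) fun s _ w hw => (?_ : _ ≤ w.im).trans (im_le_norm_sub w s)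
  have h1 : |(w - z).im| ≤ z.im / 2 := (Complex.abs_im_le_norm _).trans
    (mem_ball_iff_norm.1 hw).le
  rw [Complex.sub_im] at h1
  linarith [(abs_le.1 h1).1]

theorem integrable_div_sub {f : ℝ → ℝ} (hf : Integrable f) {z : ℂ} (hz : 0 < z.im) :
    Integrable (fun s : ℝ => (f s : ℂ) / (z - s)) := by
  have h1 : Measurable (fun s : ℝ => (z - (s : ℂ))⁻¹) := by fun_prop
  simp only [div_eq_mul_inv]
  refine (hf.ofReal (𝕜 := ℂ)).mul_bdd (c := z.im⁻¹) h1.aestronglyMeasurable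
    (Eventually.of_forall fun s => ?_)
  rw [norm_inv]
  exact inv_anti₀ hz (im_le_norm_sub z s)

theorem norm_cauchyTransform_le {f : ℝ → ℝ} (hf : Integrable f) {z : ℂ} (hz : 0 < z.im) :
    ‖cauchyTransform f z‖ ≤ (∫ s, |f s|) / z.im := by
  have h1 : ‖∫ s : ℝ, (f s : ℂ) / (z - s)‖ ≤ ∫ s, |f s| / z.im := by
    refine norm_integral_le_of_norm_le (hf.abs.div_const _) (Eventually.of_forall fun s => ?_)
    rw [norm_div, Complex.norm_real, Real.norm_eq_abs]
    exact div_le_div_of_nonneg_left (abs_nonneg _) hz (im_le_norm_sub z s)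
  rw [integral_div] at h1
  have h2 : ‖Complex.I / (2 * (Real.pi : ℂ))‖ ≤ 1 := by
    rw [norm_div, norm_mul, Complex.norm_I, Complex.norm_real, Real.norm_of_nonneg Real.pi_pos.le]
    refine div_le_one_of_le₀ ?_ (by positivity)
    simp
    linarith [Real.pi_gt_three]
  unfold cauchyTransform
  rw [norm_mul]
  exact (mul_le_of_le_one_left (norm_nonneg _) h2).trans h1

theorem cauchyTransform_sub {f g : ℝ → ℝ} (hf : Integrable f) (hg : Integrable g) {z : ℂ}
    (hz : 0 < z.im) :
    cauchyTransform (fun s => f s - g s) z = cauchyTransform f z - cauchyTransform g z := by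
  unfold cauchyTransform
  rw [← mul_sub, ← integral_sub (integrable_div_sub hf hz) (integrable_div_sub hg hz)]
  congr 2
  ext s
  push_cast
  ring

/-- Half the Poisson integral of `f`: positivity of the kernel drives Kolmogorov's estimate, and its
concentration gives the boundary values. -/
theorem re_cauchyTransform {f : ℝ → ℝ} (hf : Integrable f) {z : ℂ} (hz : 0 < z.im) :
    (cauchyTransform f z).re =
      ∫ s : ℝ, f s * ((2 * Real.pi)⁻¹ * (z.im / ((z.re - s) ^ 2 + z.im ^ 2))) := by
  have h1 := (integrable_div_sub hf hz).const_mul (Complex.I / (2 * (Real.pi : ℂ)))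
  have h2 := integral_re h1
  rw [integral_const_mul] at h2
  simp only [RCLike.re_eq_complex_re] at h2
  unfold cauchyTransform
  rw [← h2]
  congr 1
  ext s
  have h3 : (z.re - s) ^ 2 + z.im ^ 2 ≠ 0 := by positivity
  have h4 : Complex.normSq (z - s) = (z.re - s) ^ 2 + z.im ^ 2 := by
    rw [Complex.normSq_apply]
    simp
    ring
  have h5 : Complex.I / (2 * (Real.pi : ℂ)) * ((f s : ℂ) / (z - s)) =
      ((f s * (2 * Real.pi)⁻¹ : ℝ) : ℂ) * (Complex.I / (z - s)) := by
    push_cast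
    field_simp
  rw [h5, Complex.re_ofReal_mul, Complex.div_re, h4]
  simp
  ring

theorem tendsto_cauchyTransform_mul_I {f : ℝ → ℝ} (hf : Integrable f) :
    Tendsto (fun y : ℝ => cauchyTransform f (y * Complex.I)) atTop (𝓝 0) := by
  refine squeeze_zero_norm' ?_ (tendsto_id.const_div_atTop (∫ s, |f s|))
  filter_upwards [eventually_gt_atTop 0] with y hy
  simpa using norm_cauchyTransform_le hf (z := y * Complex.I) (by simpa using hy)

theorem continuous_cauchyTransform_line {f : ℝ → ℝ} (hf : Integrable f) {y : ℝ} (hy : 0 < y) :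
    Continuous (fun x : ℝ => cauchyTransform f (x + y * Complex.I)) :=
  (differentiableOn_cauchyTransform hf).continuousOn.comp_continuous (by fun_prop)
    (fun x => by simpa using hy)

theorem re_cauchyTransform_nonneg {f : ℝ → ℝ} (hf : Integrable f) (h0 : ∀ s, 0 ≤ f s) {z : ℂ}
    (hz : 0 < z.im) : 0 ≤ (cauchyTransform f z).re := by
  rw [re_cauchyTransform hf hz]
  exact integral_nonneg fun s => mul_nonneg (h0 s) (by positivity)

/-! ### Kolmogorov's estimate -/

/-- The root `v` of `w + 1` satisfies `(Re v)² - (Im v)² = Re w + 1 ≥ 0`, hence `|w| ≤ |v|² ≤ 2 (Re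
v)²`. Adding `1` keeps away from the branch point. -/
theorem norm_rpow_half_le_re_sqrt {w : ℂ} (hw : 0 ≤ w.re) :
    ‖w‖ ^ (1 / 2 : ℝ) ≤ √2 * ((w + 1) ^ (1 / 2 : ℂ)).re := by
  have hne : w + 1 ≠ 0 := by
    intro h
    have := congrArg Complex.re h
    simp at this
    linarith
  set v := (w + 1) ^ (1 / 2 : ℂ) with hv
  have hv2 : v ^ 2 = w + 1 := by
    rw [hv, ← Complex.cpow_nat_mul]
    norm_num
  have hre : 0 ≤ v.re := by
    rw [hv, Complex.cpow_def_of_ne_zero hne, Complex.exp_re]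
    refine mul_nonneg (Real.exp_pos _).le (Real.cos_nonneg_of_mem_Icc ?_)
    have h1 : (Complex.log (w + 1) * (1 / 2)).im = (w + 1).arg / 2 := by
      rw [show (1 / 2 : ℂ) = ((1 / 2 : ℝ) : ℂ) by push_cast; rfl, mul_comm, Complex.im_ofReal_mul,
        Complex.log_im]
      ring
    rw [h1]
    have h2 := Complex.neg_pi_lt_arg (w + 1)
    have h3 := Complex.arg_le_pi (w + 1)
    constructor <;> linarith
  have h1 : (v ^ 2).re = w.re + 1 := by rw [hv2]; simp
  have h2 : v.re ^ 2 - v.im ^ 2 = w.re + 1 := by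
    rw [← h1, sq v, Complex.mul_re]
    ring
  have h3 : ‖w‖ ≤ ‖w + 1‖ := by
    refine (pow_le_pow_iff_left₀ (norm_nonneg _) (norm_nonneg _) two_ne_zero).1 ?_
    rw [Complex.sq_norm, Complex.sq_norm, Complex.normSq_apply, Complex.normSq_apply]
    simp
    nlinarith
  have h4 : ‖w + 1‖ = v.re ^ 2 + v.im ^ 2 := by
    rw [← hv2, norm_pow, Complex.sq_norm, Complex.normSq_apply]
    ring
  rw [← Real.sqrt_eq_rpow]
  refine Real.sqrt_le_iff.2 ⟨by positivity, ?_⟩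
  rw [mul_pow, Real.sq_sqrt (by norm_num)]
  linarith

/-- Kolmogorov's estimate for the Cauchy transform of a nonnegative function. -/
theorem starNorm_cauchyTransform_le_of_nonneg {f : ℝ → ℝ} (hf : Integrable f)
    (h0 : ∀ s, 0 ≤ f s) {y : ℝ} (hy : 0 < y) :
    starNorm (1 / 2) (fun x : ℝ => cauchyTransform f (x + y * Complex.I)) ≤
      ENNReal.ofReal (√2 * (Real.pi * ((∫ s, |f s|) + 2))) := by
  have hA : 0 ≤ ∫ s, |f s| := integral_nonneg fun s => abs_nonneg _
  set w : ℂ → ℂ := fun z => cauchyTransform f (z + y * Complex.I) with hwdef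
  set Φ : ℂ → ℂ := fun z => (w z + 1) ^ (1 / 2 : ℂ) with hΦdef
  have him : ∀ z : ℂ, -y < z.im → 0 < (z + y * Complex.I).im := by
    intro z hz
    simp
    linarith
  have hwre : ∀ z : ℂ, -y < z.im → 0 ≤ (w z).re := fun z hz =>
    re_cauchyTransform_nonneg hf h0 (him z hz)
  have hwd : DifferentiableOn ℂ w {z : ℂ | -y < z.im} :=
    (differentiableOn_cauchyTransform hf).comp (by fun_prop) him
  have hΦd : DifferentiableOn ℂ Φ {z : ℂ | -y < z.im} := by
    refine DifferentiableOn.cpow_const (hwd.add_const 1) fun z hz => Or.inl ?_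
    have := hwre z hz
    simp
    linarith
  have hΦn : ∀ z : ℂ, ‖Φ z‖ ≤ ‖w z‖ + 2 := by
    intro z
    have h1 : Φ z ^ 2 = w z + 1 := by
      simp only [hΦdef]
      rw [← Complex.cpow_nat_mul]
      norm_num
    have h2 : ‖Φ z‖ ^ 2 ≤ ‖w z‖ + 1 := by
      rw [← norm_pow, h1]
      exact (norm_add_le _ _).trans (by simp)
    nlinarith [sq_nonneg (‖Φ z‖ - 1)]
  have hΦb : ∀ z : ℂ, 0 ≤ z.im → ‖Φ z‖ ≤ (∫ s, |f s|) / y + 2 := by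
    intro z hz
    have h1 := norm_cauchyTransform_le hf (him z (by linarith))
    have h2 : y ≤ (z + y * Complex.I).im := by simpa using hz
    have h3 := h1.trans (div_le_div_of_nonneg_left hA hy h2)
    linarith [hΦn z]
  have hΦc : ContinuousOn Φ {z : ℂ | 0 ≤ z.im} := hΦd.continuousOn.mono
    fun z (hz : 0 ≤ z.im) => show -y < z.im by linarith
  have hP := integral_div_one_add_sq_eq hΦc (hΦd.mono
    fun z (hz : 0 < z.im) => show -y < z.im by linarith) hΦb
  -- The point `i + iy` has height at least `1`, so this bound, unlike `hΦb`, does not depend on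
  -- `y`.
  have hΦI : ‖Φ Complex.I‖ ≤ (∫ s, |f s|) + 2 := by
    have h1 := norm_cauchyTransform_le hf (him Complex.I (by simp; linarith))
    have h2 : (1 : ℝ) ≤ (Complex.I + y * Complex.I).im := by simpa using hy.le
    have h3 := h1.trans (div_le_div_of_nonneg_left hA one_pos h2)
    rw [div_one] at h3
    linarith [hΦn Complex.I]
  have hΦcr : Continuous (fun x : ℝ => Φ x) :=
    hΦc.comp_continuous Complex.continuous_ofReal (fun x => by simp)
  have hint := integrable_div_one_add_sq hΦcr.aestronglyMeasurable (fun x => hΦb x (by simp))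
  have hre := integral_re hint
  rw [hP] at hre
  simp only [RCLike.re_eq_complex_re] at hre
  have hval : ∀ x : ℝ, (Φ x / (1 + (x : ℂ) ^ 2)).re = (Φ x).re / (1 + x ^ 2) := by
    intro x
    rw [show (1 + (x : ℂ) ^ 2) = ((1 + x ^ 2 : ℝ) : ℂ) by push_cast; rfl, Complex.div_ofReal_re]
  have hpt : ∀ x : ℝ, ‖w x‖ ^ (1 / 2 : ℝ) / (1 + x ^ 2) ≤
      √2 * (Φ x / (1 + (x : ℂ) ^ 2)).re := by
    intro x
    rw [hval, ← mul_div_assoc]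
    refine div_le_div_of_nonneg_right ?_ (by positivity)
    exact norm_rpow_half_le_re_sqrt (hwre x (by simpa using hy))
  have hint2 : Integrable (fun x : ℝ => √2 * (Φ x / (1 + (x : ℂ) ^ 2)).re) :=
    hint.re.const_mul _
  calc starNorm (1 / 2) (fun x : ℝ => cauchyTransform f (x + y * Complex.I))
      ≤ ∫⁻ x : ℝ, ENNReal.ofReal (√2 * (Φ x / (1 + (x : ℂ) ^ 2)).re) :=
        lintegral_mono fun x => ENNReal.ofReal_le_ofReal (hpt x)
    _ = ENNReal.ofReal (∫ x : ℝ, √2 * (Φ x / (1 + (x : ℂ) ^ 2)).re) := by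
        rw [ofReal_integral_eq_lintegral_ofReal hint2 (Eventually.of_forall fun x => ?_)]
        exact le_trans (by positivity) (hpt x)
    _ ≤ _ := by
        refine ENNReal.ofReal_le_ofReal ?_
        rw [integral_const_mul, hre, Complex.re_ofReal_mul]
        gcongr
        exact (Complex.re_le_norm _).trans hΦI

theorem starNorm_half_sub_le {a b : ℝ → ℂ} (ha : Measurable a) :
    starNorm (1 / 2) (fun x => a x - b x) ≤ starNorm (1 / 2) a + starNorm (1 / 2) b := by
  unfold starNorm
  rw [← lintegral_add_left (by fun_prop)]
  refine lintegral_mono fun x => ?_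
  rw [← ENNReal.ofReal_add (by positivity) (by positivity), ← add_div]
  refine ENNReal.ofReal_le_ofReal (div_le_div_of_nonneg_right ?_ (by positivity))
  exact (Real.rpow_le_rpow (norm_nonneg _) (norm_sub_le _ _) (by norm_num)).trans
    (Real.rpow_add_le_add_rpow (norm_nonneg _) (norm_nonneg _) (by norm_num) (by norm_num))

theorem cauchyTransform_eq_posPart_sub_negPart {f : ℝ → ℝ} (hf : Integrable f) {z : ℂ}
    (hz : 0 < z.im) : cauchyTransform f z =
      cauchyTransform (fun s => max (f s) 0) z - cauchyTransform (fun s => max (-f s) 0) z := by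
  rw [← cauchyTransform_sub hf.pos_part hf.neg_part hz]
  congr 1
  ext s
  rcases le_total (f s) 0 with h | h
  · simp [h]
  · simp [h]

/-- Kolmogorov's estimate for the Cauchy transform of an integrable function. -/
theorem starNorm_cauchyTransform_le {f : ℝ → ℝ} (hf : Integrable f) {y : ℝ} (hy : 0 < y) :
    starNorm (1 / 2) (fun x : ℝ => cauchyTransform f (x + y * Complex.I)) ≤
      ENNReal.ofReal (2 * √2 * Real.pi * (∫ s, |f s|) + 4 * √2 * Real.pi) := by
  have h1 := starNorm_cauchyTransform_le_of_nonneg hf.pos_part (fun s => le_max_right _ _) hy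
  have h2 := starNorm_cauchyTransform_le_of_nonneg hf.neg_part (fun s => le_max_right _ _) hy
  have e : (fun x : ℝ => cauchyTransform f (x + y * Complex.I)) = fun x : ℝ =>
      cauchyTransform (fun s => max (f s) 0) (x + y * Complex.I) -
        cauchyTransform (fun s => max (-f s) 0) (x + y * Complex.I) := by
    ext x
    exact cauchyTransform_eq_posPart_sub_negPart hf (by simpa using hy)
  rw [e]
  refine (starNorm_half_sub_le
    (continuous_cauchyTransform_line hf.pos_part hy).measurable).trans ?_
  refine (add_le_add h1 h2).trans ?_
  have hpos : ∀ g : ℝ → ℝ, 0 ≤ ∫ s, |g s| := fun g => integral_nonneg fun s => abs_nonneg _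
  rw [← ENNReal.ofReal_add (by have := hpos (fun s => max (f s) 0); positivity)
    (by have := hpos (fun s => max (-f s) 0); positivity)]
  refine ENNReal.ofReal_le_ofReal ?_
  have i1 : ∫ s, |max (f s) 0| ≤ ∫ s, |f s| := integral_mono hf.pos_part.abs hf.abs fun s => by
    simp only []
    rw [abs_of_nonneg (le_max_right _ _)]
    exact max_le (le_abs_self _) (abs_nonneg _)
  have i2 : ∫ s, |max (-f s) 0| ≤ ∫ s, |f s| := integral_mono hf.neg_part.abs hf.abs fun s => by
    simp only []
    rw [abs_of_nonneg (le_max_right _ _)]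
    exact max_le (neg_le_abs _) (abs_nonneg _)
  have hc : 0 < √2 * Real.pi := by positivity
  nlinarith

/-! ### Angular limits of the Cauchy transform -/

theorem HasAngularLimit.sub {g h : ℂ → ℂ} {x : ℝ} {a b : ℂ} (hg : HasAngularLimit g x a)
    (hh : HasAngularLimit h x b) : HasAngularLimit (fun z => g z - h z) x (a - b) :=
  fun α hα => (hg α hα).sub (hh α hα)

theorem HasAngularLimit.congr {g h : ℂ → ℂ} {x : ℝ} {a : ℂ} (hg : HasAngularLimit g x a)
    (heq : ∀ z : ℂ, 0 < z.im → g z = h z) : HasAngularLimit h x a := by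
  intro α hα
  refine (hg α hα).congr' ?_
  filter_upwards [self_mem_nhdsWithin] with z hz using heq z hz.1

theorem tendsto_vertical_nhdsWithin_stolz (x : ℝ) {α : ℝ} (hα : 0 < α) :
    Tendsto (fun y : ℝ => (x : ℂ) + y * Complex.I) (𝓝[>] 0)
      (𝓝[{z : ℂ | 0 < z.im ∧ |z.re - x| < α * z.im}] (x : ℂ)) := by
  refine tendsto_nhdsWithin_iff.2 ⟨?_, ?_⟩
  · have : Continuous (fun y : ℝ => (x : ℂ) + y * Complex.I) := by fun_prop
    have := this.tendsto 0
    simp only [Complex.ofReal_zero, zero_mul, add_zero] at this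
    exact this.mono_left nhdsWithin_le_nhds
  · filter_upwards [self_mem_nhdsWithin] with y (hy : 0 < y)
    refine ⟨by simpa using hy, ?_⟩
    simp
    positivity

/-- A sequence of heights, so that Fatou's lemma and measurability of limits apply. -/
theorem HasAngularLimit.tendsto_vertical {h : ℂ → ℂ} {x : ℝ} {a : ℂ} (hh : HasAngularLimit h x a) :
    Tendsto (fun n : ℕ => h (x + ((1 / ((n : ℝ) + 1) : ℝ) : ℂ) * Complex.I)) atTop (𝓝 a) := by
  refine ((hh 1 one_pos).comp (tendsto_vertical_nhdsWithin_stolz x one_pos)).comp ?_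
  exact tendsto_nhdsWithin_iff.2 ⟨tendsto_one_div_add_atTop_nhds_zero_nat,
    Eventually.of_forall fun n => Set.mem_Ioi.2 Nat.one_div_pos_of_nat⟩

/-- Fatou's lemma for boundary values along vertical lines. -/
theorem lintegral_liminf_vertical_le {h : ℂ → ℂ} (hh : DifferentiableOn ℂ h {z | 0 < z.im})
    {B : ℝ≥0∞} (hB : ∀ y : ℝ, 0 < y → starNorm (1 / 2) (fun x : ℝ => h (x + y * Complex.I)) ≤ B) :
    (∀ n : ℕ, Measurable fun x : ℝ => ENNReal.ofReal
      (‖h (x + ((1 / ((n : ℝ) + 1) : ℝ) : ℂ) * Complex.I)‖ ^ (1 / 2 : ℝ) / (1 + x ^ 2))) ∧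
    ∫⁻ x : ℝ, liminf (fun n : ℕ => ENNReal.ofReal
      (‖h (x + ((1 / ((n : ℝ) + 1) : ℝ) : ℂ) * Complex.I)‖ ^ (1 / 2 : ℝ) / (1 + x ^ 2))) atTop
      ≤ B := by
  have hm : ∀ n : ℕ, Measurable fun x : ℝ => ENNReal.ofReal
      (‖h (x + ((1 / ((n : ℝ) + 1) : ℝ) : ℂ) * Complex.I)‖ ^ (1 / 2 : ℝ) / (1 + x ^ 2)) := by
    intro n
    have h1 : Continuous fun x : ℝ => h (x + ((1 / ((n : ℝ) + 1) : ℝ) : ℂ) * Complex.I) := by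
      refine hh.continuousOn.comp_continuous (by fun_prop) fun x => ?_
      have : (0 : ℝ) < 1 / ((n : ℝ) + 1) := Nat.one_div_pos_of_nat
      simpa only [Complex.add_im, Complex.ofReal_im, Complex.mul_im, Complex.ofReal_re,
        Complex.I_im, mul_one, Complex.I_re, mul_zero, add_zero, zero_add, Set.mem_ofPred_eq]
        using this
    exact ((h1.measurable.norm.pow_const _).div (by fun_prop)).ennreal_ofReal
  refine ⟨hm, (lintegral_liminf_le hm).trans ?_⟩
  refine liminf_le_of_frequently_le' (Frequently.of_forall fun n => ?_)
  exact hB _ Nat.one_div_pos_of_nat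

theorem starNorm_half_le_of_ae_hasAngularLimit {h : ℂ → ℂ} {hb : ℝ → ℂ}
    (hh : DifferentiableOn ℂ h {z | 0 < z.im})
    {B : ℝ≥0∞} (hB : ∀ y : ℝ, 0 < y → starNorm (1 / 2) (fun x : ℝ => h (x + y * Complex.I)) ≤ B)
    (hlim : ∀ᵐ x : ℝ, HasAngularLimit h x (hb x)) : starNorm (1 / 2) hb ≤ B := by
  refine le_trans (le_of_eq ?_) (lintegral_liminf_vertical_le hh hB).2
  refine lintegral_congr_ae ?_
  filter_upwards [hlim] with x hx
  refine (Tendsto.liminf_eq ?_).symm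
  refine (ENNReal.continuous_ofReal.tendsto _).comp (Tendsto.div_const ?_ _)
  exact (hx.tendsto_vertical.norm).rpow_const (Or.inr (by norm_num))

/-- Fatou's theorem gives a limit `c` of `1 / (w + 1)`. If `c = 0` then `|w| → ∞` along the
vertical, so the `liminf` is infinite; by Fatou's lemma and Kolmogorov's estimate this happens only
on a null set. -/
theorem ae_exists_hasAngularLimit_cauchyTransform_of_nonneg {f : ℝ → ℝ} (hf : Integrable f)
    (h0 : ∀ s, 0 ≤ f s) : ∀ᵐ x : ℝ, ∃ c : ℂ, HasAngularLimit (cauchyTransform f) x c := by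
  have hre : ∀ z : ℂ, 0 < z.im → 1 ≤ (cauchyTransform f z + 1).re := by
    intro z hz
    have := re_cauchyTransform_nonneg hf h0 hz
    simpa using this
  have hne : ∀ z : ℂ, 0 < z.im → cauchyTransform f z + 1 ≠ 0 := by
    intro z hz h
    have := hre z hz
    rw [h] at this
    norm_num at this
  have hd := differentiableOn_cauchyTransform hf
  have hG : DifferentiableOn ℂ (fun z => (cauchyTransform f z + 1)⁻¹) {z | 0 < z.im} :=
    (hd.add_const 1).inv hne
  have hGb : ∀ z : ℂ, 0 < z.im → ‖(cauchyTransform f z + 1)⁻¹‖ ≤ 1 := by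
    intro z hz
    rw [norm_inv]
    exact inv_le_one_of_one_le₀ ((hre z hz).trans (Complex.re_le_norm _))
  obtain ⟨hm, hle⟩ := lintegral_liminf_vertical_le hd
    (fun y hy => starNorm_cauchyTransform_le hf hy)
  have hfin := ae_lt_top (Measurable.liminf hm) (ne_top_of_le_ne_top ENNReal.ofReal_ne_top hle)
  filter_upwards [ae_exists_hasAngularLimit_of_bounded hG hGb, hfin] with x ⟨c, hc⟩ hx
  have hc0 : c ≠ 0 := by
    rintro rfl
    refine hx.ne (Tendsto.liminf_eq ?_)
    have h1 : Tendsto (fun n : ℕ =>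
        ‖cauchyTransform f (x + ((1 / ((n : ℝ) + 1) : ℝ) : ℂ) * Complex.I) + 1‖) atTop atTop := by
      have h2 := hc.tendsto_vertical.norm
      rw [norm_zero] at h2
      have h3 : Tendsto (fun n : ℕ => ‖(cauchyTransform f
          (x + ((1 / ((n : ℝ) + 1) : ℝ) : ℂ) * Complex.I) + 1)⁻¹‖) atTop (𝓝[>] 0) := by
        refine tendsto_nhdsWithin_iff.2 ⟨h2, Eventually.of_forall fun n => ?_⟩
        refine norm_pos_iff.2 (inv_ne_zero (hne _ ?_))
        have : (0 : ℝ) < 1 / ((n : ℝ) + 1) := Nat.one_div_pos_of_nat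
        simpa only [Complex.add_im, Complex.ofReal_im, Complex.mul_im, Complex.ofReal_re,
          Complex.I_im, mul_one, Complex.I_re, mul_zero, add_zero, zero_add] using this
      refine h3.inv_tendsto_nhdsGT_zero.congr fun n => ?_
      simp only [Pi.inv_apply, norm_inv, inv_inv]
    have h2 : Tendsto (fun n : ℕ =>
        ‖cauchyTransform f (x + ((1 / ((n : ℝ) + 1) : ℝ) : ℂ) * Complex.I)‖) atTop atTop := by
      refine tendsto_atTop_mono (fun n => ?_) (tendsto_atTop_add_const_right atTop (-1 : ℝ) h1)
      have := norm_add_le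
        (cauchyTransform f (x + ((1 / ((n : ℝ) + 1) : ℝ) : ℂ) * Complex.I)) 1
      rw [norm_one] at this
      linarith
    refine ENNReal.tendsto_ofReal_atTop.comp (Tendsto.atTop_div_const (by positivity) ?_)
    exact (tendsto_rpow_atTop (by norm_num)).comp h2
  refine ⟨c⁻¹ - 1, fun α hα => ?_⟩
  have := ((hc α hα).inv₀ hc0).sub_const 1
  simpa using this

theorem ae_exists_hasAngularLimit_cauchyTransform {f : ℝ → ℝ} (hf : Integrable f) :
    ∀ᵐ x : ℝ, ∃ c : ℂ, HasAngularLimit (cauchyTransform f) x c := by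
  filter_upwards [ae_exists_hasAngularLimit_cauchyTransform_of_nonneg hf.pos_part
    (fun s => le_max_right _ _), ae_exists_hasAngularLimit_cauchyTransform_of_nonneg hf.neg_part
    (fun s => le_max_right _ _)] with x ⟨a, ha⟩ ⟨b, hb⟩
  exact ⟨a - b, (ha.sub hb).congr fun z hz => (cauchyTransform_eq_posPart_sub_negPart hf hz).symm⟩

/-! ### The boundary identity `f = h + conj h` -/

theorem two_mul_re_cauchyTransform {f : ℝ → ℝ} (hf : Integrable f) {y : ℝ} (hy : 0 < y) (x : ℝ) :
    2 * (cauchyTransform f (x + y * Complex.I)).re =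
      ∫ s : ℝ, (y⁻¹ * (Real.pi⁻¹ * (1 + (y⁻¹ * (x - s)) ^ 2)⁻¹)) * f s := by
  rw [re_cauchyTransform hf (by simpa using hy), ← integral_const_mul]
  congr 1
  ext s
  simp
  have h1 : (x - s) ^ 2 + y ^ 2 ≠ 0 := by positivity
  have h2 : 1 + (y⁻¹ * (x - s)) ^ 2 ≠ 0 := by positivity
  have h3 : 1 + (y⁻¹ * (x - s)) ^ 2 = ((x - s) ^ 2 + y ^ 2) / y ^ 2 := by
    field_simp
    ring
  have h4 : y⁻¹ ^ 2 * (x - s) ^ 2 + 1 ≠ 0 := by positivity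
  rw [← mul_inv, h3]
  field_simp

theorem lintegral_poissonKernel {y : ℝ} (hy : 0 < y) (s : ℝ) :
    ∫⁻ x : ℝ, ENNReal.ofReal (y⁻¹ * (Real.pi⁻¹ * (1 + (y⁻¹ * (x - s)) ^ 2)⁻¹)) = 1 := by
  rw [lintegral_sub_right_eq_self (μ := volume)
    (fun x : ℝ => ENNReal.ofReal (y⁻¹ * (Real.pi⁻¹ * (1 + (y⁻¹ * x) ^ 2)⁻¹))) s]
  have hi : Integrable fun x : ℝ => y⁻¹ * (Real.pi⁻¹ * (1 + (y⁻¹ * x) ^ 2)⁻¹) :=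
    ((integrable_inv_one_add_sq.comp_mul_left' (inv_ne_zero hy.ne')).const_mul _).const_mul _
  rw [← ofReal_integral_eq_lintegral_ofReal hi (Eventually.of_forall fun x => by
    simp only [Pi.zero_apply]; positivity), integral_const_mul, integral_const_mul,
    Measure.integral_comp_mul_left (fun x : ℝ => (1 + x ^ 2)⁻¹), integral_univ_inv_one_add_sq]
  rw [inv_inv, abs_of_pos hy, smul_eq_mul]
  have : y⁻¹ * (Real.pi⁻¹ * (y * Real.pi)) = 1 := by field_simp
  rw [this, ENNReal.ofReal_one]

/-- By Tonelli, since the Poisson kernel has unit mass in `x` for every `s`. -/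
theorem lintegral_re_cauchyTransform_le {f : ℝ → ℝ} (hf : Integrable f) {y : ℝ} (hy : 0 < y) :
    ∫⁻ x : ℝ, ‖2 * (cauchyTransform f (x + y * Complex.I)).re‖ₑ ≤ ∫⁻ s, ‖f s‖ₑ := by
  calc ∫⁻ x : ℝ, ‖2 * (cauchyTransform f (x + y * Complex.I)).re‖ₑ
      ≤ ∫⁻ x : ℝ, ∫⁻ s : ℝ, ENNReal.ofReal (y⁻¹ * (Real.pi⁻¹ * (1 + (y⁻¹ * (x - s)) ^ 2)⁻¹)) *
          ‖f s‖ₑ := by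
        refine lintegral_mono fun x => ?_
        rw [two_mul_re_cauchyTransform hf hy]
        refine (enorm_integral_le_lintegral_enorm _).trans (lintegral_mono fun s => ?_)
        rw [enorm_mul, Real.enorm_of_nonneg (by positivity)]
    _ = ∫⁻ s : ℝ, ∫⁻ x : ℝ, ENNReal.ofReal (y⁻¹ * (Real.pi⁻¹ * (1 + (y⁻¹ * (x - s)) ^ 2)⁻¹)) *
          ‖f s‖ₑ := by
        refine lintegral_lintegral_swap ?_
        have h1 : Measurable (fun p : ℝ × ℝ => ENNReal.ofReal
            (y⁻¹ * (Real.pi⁻¹ * (1 + (y⁻¹ * (p.1 - p.2)) ^ 2)⁻¹))) := by fun_prop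
        exact h1.aemeasurable.mul hf.aestronglyMeasurable.enorm.comp_snd
    _ = ∫⁻ s, ‖f s‖ₑ := by
        refine lintegral_congr fun s => ?_
        rw [lintegral_mul_const _ (by fun_prop), lintegral_poissonKernel hy, one_mul]

theorem tendsto_re_cauchyTransform_of_continuous {g : ℝ → ℝ} (hg : Integrable g)
    (hgc : Continuous g) (x : ℝ) :
    Tendsto (fun n : ℕ =>
      2 * (cauchyTransform g (x + ((1 / ((n : ℝ) + 1) : ℝ) : ℂ) * Complex.I)).re)
      atTop (𝓝 (g x)) := by
  have hφ : ∀ t : ℝ, 0 ≤ Real.pi⁻¹ * (1 + t ^ 2)⁻¹ := fun t => by positivity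
  have hφ1 : ∫ t : ℝ, Real.pi⁻¹ * (1 + t ^ 2)⁻¹ = 1 := by
    rw [integral_const_mul, integral_univ_inv_one_add_sq, inv_mul_cancel₀ Real.pi_ne_zero]
  have hdec : Tendsto (fun t : ℝ => ‖t‖ ^ Module.finrank ℝ ℝ * (Real.pi⁻¹ * (1 + t ^ 2)⁻¹))
      (Bornology.cobounded ℝ) (𝓝 0) := by
    refine squeeze_zero (fun t => by positivity) (fun t => ?_)
      (tendsto_norm_cobounded_atTop.inv_tendsto_atTop)
    rw [Module.finrank_self, pow_one, Pi.inv_apply]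
    have h1 : Real.pi⁻¹ ≤ 1 := inv_le_one_of_one_le₀ (by linarith [Real.pi_gt_three])
    rcases eq_or_ne t 0 with rfl | ht
    · simp
    have h2 : 0 < ‖t‖ := norm_pos_iff.2 ht
    have h3 : t ^ 2 = ‖t‖ ^ 2 := by simp
    rw [h3]
    calc ‖t‖ * (Real.pi⁻¹ * (1 + ‖t‖ ^ 2)⁻¹) ≤ ‖t‖ * (1 * (‖t‖ ^ 2)⁻¹) := by
          gcongr
          linarith
      _ = ‖t‖⁻¹ := by field_simp
  have h := tendsto_integral_comp_smul_smul_of_integrable' (μ := (volume : Measure ℝ)) hφ hφ1 hdec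
    hg (hgc.continuousAt (x := x))
  have hn : Tendsto (fun n : ℕ => (n : ℝ) + 1) atTop atTop :=
    tendsto_atTop_add_const_right _ _ tendsto_natCast_atTop_atTop
  refine (h.comp hn).congr fun n => ?_
  have hy : (0 : ℝ) < 1 / ((n : ℝ) + 1) := Nat.one_div_pos_of_nat
  rw [two_mul_re_cauchyTransform hg hy]
  simp

/-- As the limit `v` of the Poisson integrals is known to exist, no maximal function is needed. For
continuous `g` close to `f` in `L¹`, contraction and Fatou's lemma give `‖v - g‖₁ ≤ ‖f - g‖₁`,
whence `‖v - f‖₁ ≤ 2 ‖f - g‖₁`. -/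
theorem eq_add_conj_of_ae_hasAngularLimit {f : ℝ → ℝ} (hf : Integrable f) {hb : ℝ → ℂ}
    (hlim : ∀ᵐ x : ℝ, HasAngularLimit (cauchyTransform f) x (hb x)) :
    ∀ᵐ x : ℝ, (f x : ℂ) = hb x + conj (hb x) := by
  set v : ℝ → ℝ := fun x => 2 * (hb x).re with hv
  have hvt : ∀ᵐ x : ℝ, Tendsto (fun n : ℕ =>
      2 * (cauchyTransform f (x + ((1 / ((n : ℝ) + 1) : ℝ) : ℂ) * Complex.I)).re)
      atTop (𝓝 (v x)) := by
    filter_upwards [hlim] with x hx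
    exact ((Complex.continuous_re.tendsto _).comp hx.tendsto_vertical).const_mul 2
  have hmeas : ∀ (g : ℝ → ℝ), Integrable g → ∀ n : ℕ, Measurable fun x : ℝ =>
      2 * (cauchyTransform g (x + ((1 / ((n : ℝ) + 1) : ℝ) : ℂ) * Complex.I)).re := by
    intro g hg n
    have h1 := (continuous_cauchyTransform_line hg
      (y := 1 / ((n : ℝ) + 1)) Nat.one_div_pos_of_nat)
    exact ((Complex.continuous_re.comp h1).const_mul 2).measurable
  have hvm : AEMeasurable v :=
    aemeasurable_of_tendsto_metrizable_ae atTop (fun n => (hmeas f hf n).aemeasurable) hvt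
  have hzero : ∫⁻ x, ‖v x - f x‖ₑ = 0 := by
    refine le_antisymm (ENNReal.le_of_forall_pos_le_add fun ε hε _ => ?_) (zero_le)
    have hε2 : ((ε / 2 : NNReal) : ℝ≥0∞) ≠ 0 := by
      simpa using hε.ne'
    obtain ⟨g, -, hgle, hgc, hgi⟩ := hf.exists_hasCompactSupport_lintegral_sub_le hε2
    have h1 : ∫⁻ x, ‖v x - g x‖ₑ ≤ ∫⁻ x, ‖f x - g x‖ₑ := by
      have hr : Integrable fun s => f s - g s := hf.sub hgi
      calc ∫⁻ x, ‖v x - g x‖ₑ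
          = ∫⁻ x : ℝ, liminf (fun n : ℕ => ‖2 * (cauchyTransform (fun s => f s - g s)
              (x + ((1 / ((n : ℝ) + 1) : ℝ) : ℂ) * Complex.I)).re‖ₑ) atTop := by
            refine lintegral_congr_ae ?_
            filter_upwards [hvt] with x hx
            have h2 := (hx.sub (tendsto_re_cauchyTransform_of_continuous hgi hgc x)).enorm
            refine (h2.congr fun n => ?_).liminf_eq.symm
            have hy : (0 : ℝ) < 1 / ((n : ℝ) + 1) := Nat.one_div_pos_of_nat
            rw [cauchyTransform_sub hf hgi (by simpa only [Complex.add_im, Complex.ofReal_im,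
              Complex.mul_im, Complex.ofReal_re, Complex.I_im, mul_one, Complex.I_re, mul_zero,
              add_zero, zero_add] using hy), Complex.sub_re, mul_sub]
        _ ≤ liminf (fun n : ℕ => ∫⁻ x : ℝ, ‖2 * (cauchyTransform (fun s => f s - g s)
              (x + ((1 / ((n : ℝ) + 1) : ℝ) : ℂ) * Complex.I)).re‖ₑ) atTop :=
            lintegral_liminf_le fun n => (hmeas _ hr n).enorm
        _ ≤ _ := liminf_le_of_frequently_le' (Frequently.of_forall fun n =>
            lintegral_re_cauchyTransform_le hr Nat.one_div_pos_of_nat)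
    calc ∫⁻ x, ‖v x - f x‖ₑ ≤ ∫⁻ x, (‖v x - g x‖ₑ + ‖f x - g x‖ₑ) := by
          refine lintegral_mono fun x => ?_
          have : v x - f x = (v x - g x) - (f x - g x) := by ring
          rw [this]
          exact enorm_sub_le
      _ = (∫⁻ x, ‖v x - g x‖ₑ) + ∫⁻ x, ‖f x - g x‖ₑ :=
          lintegral_add_left' (hvm.sub hgc.measurable.aemeasurable).enorm _
      _ ≤ (ε / 2 : NNReal) + (ε / 2 : NNReal) := add_le_add (h1.trans hgle) hgle
      _ = 0 + ε := by rw [zero_add, ← ENNReal.coe_add, add_halves]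
  have hzero := (lintegral_eq_zero_iff'
    (f := fun x => ‖v x - f x‖ₑ) (hvm.sub hf.aestronglyMeasurable.aemeasurable).enorm).1 hzero
  filter_upwards [hzero] with x hx
  have h1 : v x = f x := by simpa [sub_eq_zero] using hx
  rw [Complex.add_conj, ← h1]

/-! ### Entire continuation of the Cauchy transform -/

theorem differentiable_intervalIntegral_of_continuous {g : ℂ → ℝ → ℂ}
    (hg : Continuous (Function.uncurry g)) (hd : ∀ s, Differentiable ℂ fun z => g z s) (a b : ℝ) :
    Differentiable ℂ fun z => ∫ s in a..b, g z s := by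
  intro z₀
  -- Radius `2` contains the unit circles about all points of the unit ball at `z₀`; Cauchy's
  -- estimate on them makes `M` a bound for the derivative too.
  obtain ⟨M, hM⟩ := ((isCompact_closedBall z₀ 2).prod
    (isCompact_uIcc (a := a) (b := b))).exists_bound_of_continuousOn hg.continuousOn
  have hcs : ∀ z, Continuous (g z) := fun z => hg.comp (by fun_prop : Continuous fun s => (z, s))
  refine (intervalIntegral.hasDerivAt_integral_of_dominated_loc_of_deriv_le
    (F' := fun z s => deriv (fun w => g w s) z) (bound := fun _ => M)
    (Metric.ball_mem_nhds z₀ one_pos) (Eventually.of_forall fun z =>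
      (hcs z).aestronglyMeasurable) ((hcs z₀).intervalIntegrable _ _) ?_ ?_
    intervalIntegrable_const ?_).2.differentiableAt
  · have h1 : Continuous (Function.uncurry fun (s : ℝ) (z : ℂ) => g z s) :=
      hg.comp continuous_swap
    have h2 := stronglyMeasurable_deriv_with_param h1
    exact (h2.comp_measurable
      (by fun_prop : Measurable fun s : ℝ => (s, z₀))).aestronglyMeasurable
  · refine Eventually.of_forall fun s hs z hz => ?_
    have h1 := Complex.norm_deriv_le_of_forall_mem_sphere_norm_le (f := fun w => g w s) (c := z)
      (R := 1) (C := M) one_pos (hd s).diffContOnCl (fun w hw => ?_)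
    · simpa using h1
    · refine hM (w, s) ⟨?_, Set.uIoc_subset_uIcc hs⟩
      have h2 := dist_triangle w z z₀
      rw [mem_sphere_iff_norm, ← dist_eq_norm] at hw
      rw [Metric.mem_ball] at hz
      rw [Metric.mem_closedBall]
      linarith
  · exact Eventually.of_forall fun s _ z _ => (hd s z).hasDerivAt

/-- The difference quotient of an entire function, as an integral of its derivative. -/
noncomputable def segmentSlope (F : ℂ → ℂ) (z : ℂ) (s : ℝ) : ℂ :=
  ∫ t in (0 : ℝ)..1, deriv F (s + t * (z - s))

theorem sub_mul_segmentSlope {F : ℂ → ℂ} (hF : Differentiable ℂ F) (z : ℂ) (s : ℝ) :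
    (z - s) * segmentSlope F z s = F z - F s := by
  have hF' : Continuous (deriv F) := (hF.contDiff (n := 1)).continuous_deriv le_rfl
  have h1 := intervalIntegral.integral_unitInterval_deriv_eq_sub (f := F) (f' := deriv F) (z₀ := (s : ℂ))
    (z₁ := z - s) (by fun_prop) (fun t _ => (hF _).hasDerivAt)
  simpa [segmentSlope] using h1

theorem continuous_segmentSlope {F : ℂ → ℂ} (hF : Differentiable ℂ F) :
    Continuous (Function.uncurry (segmentSlope F)) := by
  have hF' : Continuous (deriv F) := (hF.contDiff (n := 1)).continuous_deriv le_rfl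
  refine intervalIntegral.continuous_parametric_intervalIntegral_of_continuous'
    (f := fun (p : ℂ × ℝ) (t : ℝ) => deriv F (p.2 + t * (p.1 - p.2))) ?_ 0 1
  unfold Function.uncurry
  fun_prop

theorem differentiable_segmentSlope {F : ℂ → ℂ} (hF : Differentiable ℂ F) (s : ℝ) :
    Differentiable ℂ fun z => segmentSlope F z s := by
  have hF' : Differentiable ℂ (deriv F) := fun z =>
    ((hF.analyticAt z).deriv).differentiableAt
  have hFc := hF'.continuous
  refine differentiable_intervalIntegral_of_continuous
    (g := fun (z : ℂ) (t : ℝ) => deriv F (s + t * (z - s))) ?_ (fun t => ?_) 0 1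
  · unfold Function.uncurry
    fun_prop
  · exact hF'.comp (by fun_prop)

/-- The factor `-i` turns the branch cuts downwards from `±R`, so the right side stays holomorphic
in the whole strip `|Re z| < R`. -/
theorem intervalIntegral_one_div_sub {z : ℂ} (hz : 0 < z.im) (R : ℝ) :
    ∫ s in (-R)..R, 1 / (z - s) =
      Complex.log (-Complex.I * (z + R)) - Complex.log (-Complex.I * (z - R)) := by
  have hne : ∀ s : ℝ, z - s ≠ 0 := by
    intro s h
    have := congrArg Complex.im h
    simp at this
    linarith
  have h1 : ∀ s ∈ Set.uIcc (-R) R, HasDerivAt (fun s : ℝ => -Complex.log (-Complex.I * (z - s)))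
      (1 / (z - s)) s := by
    intro s _
    have h2 : HasDerivAt (fun s : ℝ => -Complex.I * (z - s)) (Complex.I) s := by
      have h3 := ((Complex.ofRealCLM.hasDerivAt (x := s)).const_sub z).const_mul (-Complex.I)
      simpa using h3
    have h4 := (h2.clog_real (Or.inl (by simpa using hz))).neg
    convert! h4 using 1
    have := hne s
    field_simp
  rw [intervalIntegral.integral_eq_sub_of_hasDerivAt h1]
  · simp only [Complex.ofReal_neg, sub_neg_eq_add]
    ring
  · refine Continuous.intervalIntegrable ?_ _ _
    exact continuous_const.div (by fun_prop) hne

/-- The continuation of the Cauchy transform of `f` to the strip `|Re z| < R`, where `F` is an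
entire function that extends `f`. -/
noncomputable def cauchyStrip (f : ℝ → ℝ) (F : ℂ → ℂ) (R : ℝ) (z : ℂ) : ℂ :=
  Complex.I / (2 * (Real.pi : ℂ)) *
    ((∫ s : ℝ, (Set.Ioc (-R) R)ᶜ.indicator (fun s => (f s : ℂ)) s / (z - s)) -
      (∫ s in (-R)..R, segmentSlope F z s) +
      F z * (Complex.log (-Complex.I * (z + R)) - Complex.log (-Complex.I * (z - R))))

theorem differentiableAt_cauchyStrip {f : ℝ → ℝ} (hf : Integrable f) {F : ℂ → ℂ}
    (hF : Differentiable ℂ F) {R : ℝ} {z : ℂ} (hz : |z.re| < R) :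
    DifferentiableAt ℂ (cauchyStrip f F R) z := by
  obtain ⟨hz1, hz2⟩ := abs_lt.1 hz
  refine DifferentiableAt.const_mul (DifferentiableAt.add (DifferentiableAt.sub ?_ ?_) ?_) _
  · refine differentiableAt_integral_div_sub
      ((hf.ofReal (𝕜 := ℂ)).indicator measurableSet_Ioc.compl) (δ := (R - |z.re|) / 2)
      (by linarith) fun s hs w hw => ?_
    have hs' : s ∉ Set.Ioc (-R) R := by
      intro h
      exact hs (Set.indicator_of_notMem (by simpa using h) _)
    have h1 : |(w - z).re| ≤ (R - |z.re|) / 2 := (Complex.abs_re_le_norm _).trans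
      (mem_ball_iff_norm.1 hw).le
    rw [Complex.sub_re] at h1
    have h2 : |w.re| ≤ |z.re| + (R - |z.re|) / 2 := by
      have := abs_add_le (w.re - z.re) z.re
      rw [sub_add_cancel] at this
      linarith
    have h3 : R ≤ |s| := by
      rw [le_abs]
      by_contra! h
      exact hs' ⟨by linarith, h.1.le⟩
    have h4 : |s| ≤ ‖w - s‖ + |w.re| := by
      have h5 := Complex.abs_re_le_norm (w - s)
      rw [Complex.sub_re, Complex.ofReal_re, abs_sub_comm] at h5
      have h6 := abs_add_le (s - w.re) w.re
      rw [sub_add_cancel] at h6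
      linarith
    linarith
  · exact differentiable_intervalIntegral_of_continuous (continuous_segmentSlope hF)
      (differentiable_segmentSlope hF) _ _ z
  · refine (hF z).mul (DifferentiableAt.sub ?_ ?_)
    · refine DifferentiableAt.clog (by fun_prop) (Or.inr ?_)
      simp
      linarith
    · refine DifferentiableAt.clog (by fun_prop) (Or.inr ?_)
      simp
      linarith

theorem cauchyStrip_eq_cauchyTransform {f : ℝ → ℝ} (hf : Integrable f) {F : ℂ → ℂ}
    (hF : Differentiable ℂ F) (hFf : ∀ x : ℝ, F x = f x) {R : ℝ} (hR : 0 ≤ R) {z : ℂ}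
    (hz : 0 < z.im) : cauchyStrip f F R z = cauchyTransform f z := by
  have hne : ∀ s : ℝ, z - s ≠ 0 := by
    intro s h
    have := congrArg Complex.im h
    simp at this
    linarith
  have hi := integrable_div_sub hf hz
  have h1 := integral_add_compl (measurableSet_Ioc (a := -R) (b := R)) hi
  have h2 : ∫ s : ℝ, (Set.Ioc (-R) R)ᶜ.indicator (fun s => (f s : ℂ)) s / (z - s) =
      ∫ s in (Set.Ioc (-R) R)ᶜ, (f s : ℂ) / (z - s) := by
    rw [← integral_indicator measurableSet_Ioc.compl]
    congr 1
    ext s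
    by_cases hs : s ∈ (Set.Ioc (-R) R)ᶜ
    · rw [Set.indicator_of_mem hs, Set.indicator_of_mem hs]
    · rw [Set.indicator_of_notMem hs, Set.indicator_of_notMem hs, zero_div]
  have h3 : ∫ s in (-R)..R, (f s : ℂ) / (z - s) = F z * (∫ s in (-R)..R, 1 / (z - (s : ℂ))) -
      ∫ s in (-R)..R, segmentSlope F z s := by
    rw [← intervalIntegral.integral_const_mul, ← intervalIntegral.integral_sub]
    · refine intervalIntegral.integral_congr fun s _ => ?_
      have h4 := sub_mul_segmentSlope hF z s
      have h5 := hne s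
      rw [← hFf]
      field_simp
      linear_combination h4
    · refine Continuous.intervalIntegrable ?_ _ _
      exact continuous_const.mul (continuous_const.div (by fun_prop) hne)
    · refine Continuous.intervalIntegrable ?_ _ _
      exact (continuous_segmentSlope hF).comp (by fun_prop : Continuous fun s : ℝ => (z, s))
  rw [intervalIntegral_one_div_sub hz, intervalIntegral.integral_of_le (by linarith)] at h3
  unfold cauchyStrip cauchyTransform
  rw [← h1, h2, h3]
  congr 1
  ring

/-- Identity theorem on the narrower strip: both sides equal the Cauchy transform near `i`. -/
theorem cauchyStrip_eq_cauchyStrip {f : ℝ → ℝ} (hf : Integrable f) {F : ℂ → ℂ}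
    (hF : Differentiable ℂ F) (hFf : ∀ x : ℝ, F x = f x) {R R' : ℝ} (hRR : R ≤ R') {z : ℂ}
    (hz : |z.re| < R) : cauchyStrip f F R z = cauchyStrip f F R' z := by
  have hR : 0 < R := (abs_nonneg _).trans_lt hz
  set U : Set ℂ := {z : ℂ | -R < z.re} ∩ {z : ℂ | z.re < R} with hU
  have hUo : IsOpen U := (isOpen_lt continuous_const Complex.continuous_re).inter
    (isOpen_lt Complex.continuous_re continuous_const)
  have hUc : Convex ℝ U := (convex_halfSpace_re_gt _).inter (convex_halfSpace_re_lt _)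
  have hd : ∀ R'' : ℝ, R ≤ R'' → AnalyticOnNhd ℂ (cauchyStrip f F R'') U := by
    intro R'' hR''
    refine DifferentiableOn.analyticOnNhd (fun w hw => ?_) hUo
    exact (differentiableAt_cauchyStrip hf hF
      ((abs_lt.2 ⟨hw.1, hw.2⟩).trans_le hR'')).differentiableWithinAt
  refine (hd R le_rfl).eqOn_of_preconnected_of_eventuallyEq (hd R' hRR) hUc.isPreconnected
    (z₀ := Complex.I) ⟨by simpa using hR, by simpa using hR⟩ ?_ (abs_lt.1 hz)
  filter_upwards [isOpen_upperHalfPlaneSet.mem_nhds (show 0 < Complex.I.im by simp)] with w hw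
  rw [cauchyStrip_eq_cauchyTransform hf hF hFf hR.le hw,
    cauchyStrip_eq_cauchyTransform hf hF hFf (hR.le.trans hRR) hw]

/-- The Cauchy transform of an integrable function that extends to an entire function continues
to an entire function. -/
theorem exists_differentiable_eq_cauchyTransform {f : ℝ → ℝ} (hf : Integrable f) {F : ℂ → ℂ}
    (hF : Differentiable ℂ F) (hFf : ∀ x : ℝ, F x = f x) :
    ∃ h : ℂ → ℂ, Differentiable ℂ h ∧ ∀ z : ℂ, 0 < z.im → h z = cauchyTransform f z := by
  -- The width varies with `z`, but near `z₀` the values agree with those of the fixed strip of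
  -- half-width `|Re z₀| + 2`.
  refine ⟨fun z => cauchyStrip f F (|z.re| + 1) z, fun z₀ => ?_, fun z hz =>
    cauchyStrip_eq_cauchyTransform hf hF hFf (by positivity) hz⟩
  refine (differentiableAt_cauchyStrip hf hF
    (R := |z₀.re| + 2) (by linarith)).congr_of_eventuallyEq ?_
  have h1 : ∀ᶠ z : ℂ in 𝓝 z₀, |z.re| < |z₀.re| + 1 :=
    (by fun_prop : Continuous fun z : ℂ => |z.re|).continuousAt.eventually_lt_const (by linarith)
  filter_upwards [h1] with z hz
  exact cauchyStrip_eq_cauchyStrip hf hF hFf (by linarith) (by linarith)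

/-! ### Uniqueness: from the integral bound to polynomial growth to zero -/

/-- Jensen's formula, in which the zeros of `d` contribute nonnegative terms. -/
theorem log_norm_le_circleAverage {d : ℂ → ℂ} (hd : Differentiable ℂ d) {c : ℂ} (hc : d c ≠ 0)
    {r : ℝ} (hr : 0 < r) : Real.log ‖d c‖ ≤ Real.circleAverage (fun z => Real.log ‖d z‖) c r := by
  have han : AnalyticOnNhd ℂ d (Metric.closedBall c |r|) := fun z _ => hd.analyticAt z
  rw [han.circleAverage_log_norm hr.ne' hc]
  refine le_add_of_nonneg_left (finsum_nonneg fun u => ?_)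
  by_cases hu : u ∈ Metric.closedBall c |r|
  · refine mul_nonneg ?_ ?_
    · exact_mod_cast MeromorphicOn.AnalyticOnNhd.divisor_nonneg han u
    · rcases eq_or_ne c u with rfl | hcu
      · simp
      · have h1 : 0 < ‖c - u‖ := norm_pos_iff.2 (sub_ne_zero.2 hcu)
        refine Real.log_nonneg ?_
        rw [← div_eq_mul_inv, one_le_div h1]
        rwa [abs_of_pos hr, mem_closedBall_iff_norm'] at hu
  · rw [Function.locallyFinsuppWithin.apply_eq_zero_of_notMem _ hu]
    simp

/-- The tangent-line inequality `exp u ≥ exp a * (1 + u - a)` with `u = log|d z| / 2` passes from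
`log|d|` to `√|d|`. The extra `1` pays for the convention `Real.log 0 = 0`, which gives `exp u = 1`
at the zeros of `d`. -/
theorem sqrt_norm_le_circleAverage {d : ℂ → ℂ} (hd : Differentiable ℂ d) (c : ℂ)
    {r : ℝ} (hr : 0 < r) :
    √‖d c‖ ≤ 1 + Real.circleAverage (fun z => √‖d z‖) c r := by
  have hcont : Continuous fun z => √‖d z‖ := by
    have := hd.continuous
    fun_prop
  have hci : CircleIntegrable (fun z => √‖d z‖) c r := hcont.continuousOn.circleIntegrable hr.le
  by_cases hc : d c = 0
  · rw [hc, norm_zero, Real.sqrt_zero]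
    have := Real.circleAverage_nonneg_of_nonneg (c := c) (R := r) (f := fun z => √‖d z‖)
      fun x _ => Real.sqrt_nonneg _
    linarith
  have hlog := log_norm_le_circleAverage hd hc hr
  have hli : CircleIntegrable (fun z => Real.log ‖d z‖) c r :=
    MeromorphicOn.circleIntegrable_log_norm fun z _ => (hd.analyticAt z).meromorphicAt
  set e := √‖d c‖ with he
  set a := Real.log ‖d c‖ / 2 with ha
  have hea : Real.exp a = e := by
    rw [ha, he, Real.sqrt_eq_rpow, Real.rpow_def_of_pos (norm_pos_iff.2 hc)]
    ring_nf
  have hpt : ∀ z, e * (1 - a) + e / 2 * Real.log ‖d z‖ ≤ 1 + √‖d z‖ := by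
    intro z
    have h1 : e * (1 - a) + e / 2 * Real.log ‖d z‖ ≤ Real.exp (Real.log ‖d z‖ / 2) := by
      have h2 := Real.add_one_le_exp (Real.log ‖d z‖ / 2 - a)
      have h3 : Real.exp (Real.log ‖d z‖ / 2) = e * Real.exp (Real.log ‖d z‖ / 2 - a) := by
        rw [← hea, ← Real.exp_add]
        ring_nf
      rw [h3]
      have := mul_le_mul_of_nonneg_left h2 (Real.sqrt_nonneg ‖d c‖)
      rw [← he] at this
      linarith
    refine h1.trans ?_
    by_cases hz : d z = 0
    · simp [hz]
    · have h4 : Real.exp (Real.log ‖d z‖ / 2) = √‖d z‖ := by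
        rw [Real.sqrt_eq_rpow, Real.rpow_def_of_pos (norm_pos_iff.2 hz)]
        ring_nf
      linarith
  have hli' : CircleIntegrable (fun z => e / 2 * Real.log ‖d z‖) c r := hli.const_mul _
  have hmono := Real.circleAverage_mono (c := c) (R := r)
    ((circleIntegrable_const (e * (1 - a)) c r).add hli')
    ((circleIntegrable_const (1 : ℝ) c r).add hci) fun x _ => hpt x
  rw [Real.circleAverage_add (circleIntegrable_const _ c r) hli',
    Real.circleAverage_add (circleIntegrable_const _ c r) hci, Real.circleAverage_const,
    Real.circleAverage_const] at hmono
  have h5 : Real.circleAverage (fun z => e / 2 * Real.log ‖d z‖) c r =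
      e / 2 * Real.circleAverage (fun z => Real.log ‖d z‖) c r := by
    simpa using Real.circleAverage_fun_smul (a := e / 2) (f := fun z => Real.log ‖d z‖)
      (c := c) (R := r)
  rw [h5] at hmono
  have h6 : e / 2 * Real.log ‖d c‖ ≤ e / 2 * Real.circleAverage (fun z => Real.log ‖d z‖) c r :=
    mul_le_mul_of_nonneg_left hlog (by positivity)
  have h7 : e * (1 - a) + e / 2 * Real.log ‖d c‖ = e := by
    rw [ha]
    ring
  linarith

theorem ofReal_two_pi_mul_circleAverage {φ : ℂ → ℝ} (hφ : Continuous φ) (h0 : ∀ z, 0 ≤ φ z)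
    (c : ℂ) (r : ℝ) :
    ENNReal.ofReal (2 * Real.pi * Real.circleAverage φ c r) =
      ∫⁻ θ in Set.Ioo (-Real.pi) Real.pi,
        ENNReal.ofReal (φ (c + Complex.polarCoord.symm (r, θ))) := by
  have h1 : ∀ θ : ℝ, c + Complex.polarCoord.symm (r, θ) = circleMap c r θ := by
    intro θ
    rw [Complex.polarCoord_symm_apply, circleMap, Complex.exp_mul_I]
    push_cast
    rfl
  have hc : Continuous fun θ => φ (circleMap c r θ) := hφ.comp (continuous_circleMap c r)
  simp_rw [h1]
  rw [Real.circleAverage_eq_integral_add (-Real.pi), smul_eq_mul, ← mul_assoc,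
    mul_inv_cancel₀ (by positivity), one_mul,
    intervalIntegral.integral_comp_add_right (fun θ => φ (circleMap c r θ)),
    show 0 + -Real.pi = -Real.pi by ring, show 2 * Real.pi + -Real.pi = Real.pi by ring,
    intervalIntegral.integral_of_le (by linarith [Real.pi_pos]), integral_Ioc_eq_integral_Ioo,
    ofReal_integral_eq_lintegral_ofReal]
  · exact (hc.integrableOn_Icc (a := -Real.pi) (b := Real.pi)).mono_set Set.Ioo_subset_Icc_self
  · exact Eventually.of_forall fun θ => h0 _

theorem sqrt_norm_le_lintegral {d : ℂ → ℂ} (hd : Differentiable ℂ d) (c : ℂ) :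
    ENNReal.ofReal (√‖d c‖ - 1) ≤ ∫⁻ z in Metric.ball (0 : ℂ) 1, ENNReal.ofReal √‖d (c + z)‖ := by
  have hcont : Continuous fun z => √‖d z‖ := by
    have := hd.continuous
    fun_prop
  have hm : Measurable fun p : ℝ × ℝ =>
      ENNReal.ofReal √‖d (c + Complex.polarCoord.symm p)‖ := by
    have h1 : Continuous fun p : ℝ × ℝ => Complex.polarCoord.symm p := by
      simp only [Complex.polarCoord_symm_apply]
      fun_prop
    exact (hcont.comp (continuous_const.add h1)).measurable.ennreal_ofReal
  rw [← lintegral_indicator Metric.isOpen_ball.measurableSet,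
    ← Complex.lintegral_comp_polarCoord_symm]
  have hsub : Set.Ioo (1 / 2 : ℝ) 1 ×ˢ Set.Ioo (-Real.pi) Real.pi ⊆ polarCoord.target := by
    rintro ⟨r, θ⟩ ⟨hr, hθ⟩
    exact ⟨lt_trans (by norm_num) hr.1, hθ⟩
  calc ENNReal.ofReal (√‖d c‖ - 1)
      -- Radii in `(1/2, 1)` suffice: interval length `1/2`, Jacobian at least `1/2` and angle `2π`
      -- give the factor `π/2 ≥ 1`.
      ≤ ∫⁻ _ in Set.Ioo (1 / 2 : ℝ) 1, ENNReal.ofReal (1 / 2) *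
          ENNReal.ofReal (2 * Real.pi * (√‖d c‖ - 1)) := by
        rw [setLIntegral_const, Real.volume_Ioo, ← ENNReal.ofReal_mul (by norm_num),
          ← ENNReal.ofReal_mul' (by norm_num)]
        by_cases h : 0 ≤ √‖d c‖ - 1
        · refine ENNReal.ofReal_le_ofReal ?_
          nlinarith [Real.pi_gt_three]
        · rw [ENNReal.ofReal_of_nonpos (by linarith)]
          exact zero_le
    _ ≤ ∫⁻ r in Set.Ioo (1 / 2 : ℝ) 1, ∫⁻ θ in Set.Ioo (-Real.pi) Real.pi,
          ENNReal.ofReal r * ENNReal.ofReal √‖d (c + Complex.polarCoord.symm (r, θ))‖ := by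
        refine setLIntegral_mono' measurableSet_Ioo fun r hr => ?_
        have hr0 : 0 < r := lt_trans (by norm_num) hr.1
        have hmr : Measurable fun θ : ℝ =>
            ENNReal.ofReal √‖d (c + Complex.polarCoord.symm (r, θ))‖ :=
          hm.comp (by fun_prop : Measurable fun θ : ℝ => (r, θ))
        rw [lintegral_const_mul _ hmr,
          ← ofReal_two_pi_mul_circleAverage hcont (fun z => Real.sqrt_nonneg _)]
        refine mul_le_mul' (ENNReal.ofReal_le_ofReal hr.1.le) (ENNReal.ofReal_le_ofReal ?_)
        refine mul_le_mul_of_nonneg_left ?_ (by positivity)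
        linarith [sqrt_norm_le_circleAverage hd c hr0]
    _ = ∫⁻ p in Set.Ioo (1 / 2 : ℝ) 1 ×ˢ Set.Ioo (-Real.pi) Real.pi,
          ENNReal.ofReal p.1 * ENNReal.ofReal √‖d (c + Complex.polarCoord.symm p)‖ := by
        rw [Measure.volume_eq_prod, ← Measure.prod_restrict, lintegral_prod]
        exact (Measurable.mul (by fun_prop) hm).aemeasurable
    _ = ∫⁻ p in Set.Ioo (1 / 2 : ℝ) 1 ×ˢ Set.Ioo (-Real.pi) Real.pi,
          ENNReal.ofReal p.1 • (Metric.ball (0 : ℂ) 1).indicator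
            (fun z => ENNReal.ofReal √‖d (c + z)‖) (Complex.polarCoord.symm p) := by
        refine setLIntegral_congr_fun (measurableSet_Ioo.prod measurableSet_Ioo) fun p hp => ?_
        have h0 : 0 < p.1 := lt_trans (by norm_num) hp.1.1
        rw [Set.indicator_of_mem, smul_eq_mul]
        rw [mem_ball_zero_iff, Complex.norm_polarCoord_symm, abs_of_pos h0]
        exact hp.1.2
    _ ≤ _ := lintegral_mono_set hsub

/-- The disc lies in a square of side `2`, on which the weight `1 + x²` is at most `1 + (‖c‖ + 1)²`.
The square is sliced horizontally, and the slice `y = 0` is negligible. -/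
theorem lintegral_ball_le {d : ℂ → ℂ} (hd : Continuous d) {M : ℝ≥0∞}
    (hM : ∀ y : ℝ, y ≠ 0 → starNorm (1 / 2) (fun x : ℝ => d (x + y * Complex.I)) ≤ M) (c : ℂ) :
    ∫⁻ z in Metric.ball (0 : ℂ) 1, ENNReal.ofReal √‖d (c + z)‖ ≤
      ENNReal.ofReal (2 * (1 + (‖c‖ + 1) ^ 2)) * M := by
  have hm : Measurable fun z => ENNReal.ofReal √‖d z‖ :=
    (by fun_prop : Continuous fun z => √‖d z‖).measurable.ennreal_ofReal
  set T : Set (ℝ × ℝ) := Set.Icc (c.re - 1) (c.re + 1) ×ˢ Set.Icc (c.im - 1) (c.im + 1) with hT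
  have hTm : MeasurableSet T := measurableSet_Icc.prod measurableSet_Icc
  calc ∫⁻ z in Metric.ball (0 : ℂ) 1, ENNReal.ofReal √‖d (c + z)‖
      = ∫⁻ z : ℂ, (Metric.ball c 1).indicator (fun z => ENNReal.ofReal √‖d z‖) (c + z) := by
        rw [← lintegral_indicator Metric.isOpen_ball.measurableSet]
        refine lintegral_congr fun z => ?_
        by_cases hz : z ∈ Metric.ball (0 : ℂ) 1
        · rw [Set.indicator_of_mem hz, Set.indicator_of_mem]
          simpa using hz
        · rw [Set.indicator_of_notMem hz, Set.indicator_of_notMem]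
          simpa using hz
    _ = ∫⁻ z : ℂ, (Metric.ball c 1).indicator (fun z => ENNReal.ofReal √‖d z‖) z :=
        lintegral_add_left_eq_self _ c
    _ = ∫⁻ p : ℝ × ℝ, (Metric.ball c 1).indicator (fun z => ENNReal.ofReal √‖d z‖)
          (Complex.measurableEquivRealProd.symm p) :=
        (Complex.volume_preserving_equiv_real_prod.symm.lintegral_comp_emb
          Complex.measurableEquivRealProd.symm.measurableEmbedding _).symm
    _ ≤ ∫⁻ p : ℝ × ℝ, T.indicator (fun p => ENNReal.ofReal √‖d (p.1 + p.2 * Complex.I)‖) p := by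
        refine lintegral_mono fun p => ?_
        have hp : Complex.measurableEquivRealProd.symm p = p.1 + p.2 * Complex.I := by
          simp [Complex.measurableEquivRealProd_symm_apply, Complex.mk_eq_add_mul_I]
        by_cases hz : Complex.measurableEquivRealProd.symm p ∈ Metric.ball c 1
        · have hpT : p ∈ T := by
            rw [hp, mem_ball_iff_norm] at hz
            have h1 := (Complex.abs_re_le_norm _).trans hz.le
            have h2 := (Complex.abs_im_le_norm _).trans hz.le
            simp at h1 h2
            rw [abs_le] at h1 h2
            exact ⟨⟨by linarith, by linarith⟩, ⟨by linarith, by linarith⟩⟩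
          simp only []
          rw [Set.indicator_of_mem hz, Set.indicator_of_mem hpT, hp]
        · simp only []
          rw [Set.indicator_of_notMem hz]
          exact zero_le
    _ = ∫⁻ y in Set.Icc (c.im - 1) (c.im + 1), ∫⁻ x in Set.Icc (c.re - 1) (c.re + 1),
          ENNReal.ofReal √‖d (x + y * Complex.I)‖ := by
        rw [lintegral_indicator hTm, Measure.volume_eq_prod, hT, ← Measure.prod_restrict,
          lintegral_prod_symm]
        exact (hm.comp (by fun_prop :
          Measurable fun p : ℝ × ℝ => (p.1 : ℂ) + p.2 * Complex.I)).aemeasurable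
    _ ≤ ∫⁻ _ in Set.Icc (c.im - 1) (c.im + 1), ENNReal.ofReal (1 + (‖c‖ + 1) ^ 2) * M := by
        refine lintegral_mono_ae ?_
        have h0 : ∀ᵐ y : ℝ ∂volume.restrict (Set.Icc (c.im - 1) (c.im + 1)), y ≠ 0 :=
          ae_restrict_of_ae (Measure.ae_ne volume 0)
        filter_upwards [h0] with y hy
        refine le_trans ?_ (mul_le_mul_right (hM y hy) _)
        have hmy : Measurable fun x : ℝ =>
            ENNReal.ofReal (‖d (x + y * Complex.I)‖ ^ (1 / 2 : ℝ) / (1 + x ^ 2)) := by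
          have h1 : Measurable fun x : ℝ => d (x + y * Complex.I) :=
            hd.measurable.comp (by fun_prop)
          exact ((h1.norm.pow_const _).div (by fun_prop)).ennreal_ofReal
        unfold starNorm
        rw [← lintegral_const_mul _ hmy]
        refine le_trans (setLIntegral_mono' measurableSet_Icc fun x hx => ?_)
          (setLIntegral_le_lintegral _ _)
        rw [← ENNReal.ofReal_mul (by positivity)]
        refine ENNReal.ofReal_le_ofReal ?_
        rw [← Real.sqrt_eq_rpow, ← mul_div_assoc, le_div_iff₀ (by positivity), mul_comm]
        refine mul_le_mul_of_nonneg_right ?_ (Real.sqrt_nonneg _)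
        have h2 : |x| ≤ ‖c‖ + 1 := by
          have h3 := Complex.abs_re_le_norm c
          rw [abs_le] at h3 ⊢
          exact ⟨by linarith [hx.1], by linarith [hx.2]⟩
        have h4 := pow_le_pow_left₀ (abs_nonneg x) h2 2
        rw [sq_abs] at h4
        linarith
    _ = _ := by
        rw [setLIntegral_const, Real.volume_Icc, mul_right_comm,
          ← ENNReal.ofReal_mul (by positivity)]
        congr 2
        ring

/-- Liouville by induction: `(d z - d 0) / z` has growth of one degree less and also tends to zero
along the imaginary axis, so it vanishes and `d` is constant. -/
theorem eq_zero_of_norm_le_one_add_pow {d : ℂ → ℂ} (hd : Differentiable ℂ d) {C : ℝ} (n : ℕ)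
    (hb : ∀ z, ‖d z‖ ≤ C * (1 + ‖z‖) ^ n)
    (hlim : Tendsto (fun y : ℝ => d (y * Complex.I)) atTop (𝓝 0)) : d = 0 := by
  induction n generalizing d C with
  | zero =>
    have h1 : ∀ z w, d z = d w := hd.apply_eq_apply_of_bounded
      (isBounded_iff_forall_norm_le.2 ⟨C, by rintro _ ⟨z, rfl⟩; simpa using hb z⟩)
    ext z
    refine tendsto_nhds_unique (tendsto_const_nhds.congr fun y => ?_) hlim
    exact h1 z _
  | succ n ih =>
    set e := dslope d 0 with he
    have hed : Differentiable ℂ e := by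
      rw [← differentiableOn_univ] at hd ⊢
      exact (Complex.differentiableOn_dslope univ_mem).2 hd
    have hval : ∀ z, z ≠ 0 → e z = (d z - d 0) / z := by
      intro z hz
      rw [he, dslope_of_ne _ hz, slope_def_field, sub_zero]
    obtain ⟨B, hB⟩ := (isCompact_closedBall (0 : ℂ) 1).exists_bound_of_continuousOn
      hed.continuous.continuousOn
    have hB0 : 0 ≤ B := (norm_nonneg _).trans (hB 0 (by simp))
    have hC0 : 0 ≤ C := by simpa using (norm_nonneg _).trans (hb 0)
    have hez : e = 0 := by
      -- `B` serves on the unit disc; outside it `|d z - d 0| ≤ 2C(1 + |z|)^(n+1)` and `1 + |z| ≤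
      -- 2|z|` give `4C`.
      refine ih (C := B + 4 * C) hed (fun z => ?_) ?_
      · have hp : 1 ≤ (1 + ‖z‖) ^ n := one_le_pow₀ (by linarith [norm_nonneg z])
        rcases le_total ‖z‖ 1 with hz | hz
        · have h1 := hB z (by simpa using hz)
          nlinarith
        · have hz0 : 0 < ‖z‖ := by linarith
          rw [hval z (norm_pos_iff.1 hz0), norm_div, div_le_iff₀ hz0]
          have h1 : ‖d z - d 0‖ ≤ 2 * (C * (1 + ‖z‖) ^ (n + 1)) := by
            have h2 := hb 0
            have h3 : C * (1 + ‖(0 : ℂ)‖) ^ (n + 1) ≤ C * (1 + ‖z‖) ^ (n + 1) := by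
              rw [norm_zero]
              gcongr
            linarith [norm_sub_le (d z) (d 0), hb z]
          refine h1.trans ?_
          rw [pow_succ]
          have h5 : 0 ≤ C * (1 + ‖z‖) ^ n := by positivity
          have h6 : 0 ≤ B * (1 + ‖z‖) ^ n * ‖z‖ := by positivity
          nlinarith
      · have h1 : Tendsto (fun y : ℝ => (d (y * Complex.I) - d 0) * (((y⁻¹ : ℝ) : ℂ) * -Complex.I))
            atTop (𝓝 ((0 - d 0) * (((0 : ℝ) : ℂ) * -Complex.I))) :=
          (hlim.sub_const _).mul (((Complex.continuous_ofReal.tendsto _).comp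
            tendsto_inv_atTop_zero).mul_const _)
        rw [Complex.ofReal_zero, zero_mul, mul_zero] at h1
        refine h1.congr' ?_
        filter_upwards [eventually_gt_atTop 0] with y hy
        have hy0 : (y : ℂ) ≠ 0 := by exact_mod_cast hy.ne'
        rw [hval _ (mul_ne_zero hy0 Complex.I_ne_zero), div_eq_mul_inv, mul_inv, Complex.inv_I,
          Complex.ofReal_inv]
    have hconst : ∀ z, d z = d 0 := by
      intro z
      have h1 := sub_smul_dslope d 0 z
      rw [← he, hez] at h1
      exact sub_eq_zero.1 (by simpa using h1.symm)
    ext z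
    refine tendsto_nhds_unique (tendsto_const_nhds.congr fun y => ?_) hlim
    rw [hconst, hconst (y * Complex.I)]

/-- Schwarz reflection: `d` and `z ↦ -conj (d (conj z))` are entire and agree on the real line. -/
theorem norm_conj_eq_of_re_eq_zero {d : ℂ → ℂ} (hd : Differentiable ℂ d)
    (hre : ∀ x : ℝ, (d x).re = 0) (z : ℂ) : ‖d (conj z)‖ = ‖d z‖ := by
  have he : Differentiable ℂ fun z => -conj (d (conj z)) := fun z =>
    (differentiableAt_conj_conj_iff.2 (hd (conj z))).neg
  have heq : d = fun z => -conj (d (conj z)) := by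
    refine AnalyticOnNhd.eq_of_frequently_eq (z₀ := 0) (fun z _ => hd.analyticAt z)
      (fun z _ => he.analyticAt z) ?_
    have h1 : Tendsto (fun n : ℕ => ((1 / ((n : ℝ) + 1) : ℝ) : ℂ)) atTop (𝓝[≠] 0) := by
      refine tendsto_nhdsWithin_iff.2 ⟨?_, Eventually.of_forall fun n => ?_⟩
      · have := (Complex.continuous_ofReal.tendsto 0).comp
          (tendsto_one_div_add_atTop_nhds_zero_nat (𝕜 := ℝ))
        simpa only [Complex.ofReal_zero, Function.comp_def] using this
      · have : (0 : ℝ) < 1 / ((n : ℝ) + 1) := Nat.one_div_pos_of_nat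
        exact Complex.ofReal_ne_zero.2 this.ne'
    refine h1.frequently (Frequently.of_forall fun n => ?_)
    rw [Complex.conj_ofReal]
    apply Complex.ext
    · simp only [Complex.neg_re, Complex.conj_re, hre, neg_zero]
    · simp only [Complex.neg_im, Complex.conj_im, neg_neg]
  conv_rhs => rw [heq]
  rw [norm_neg, RCLike.norm_conj]

/-- An entire function of class `H^{1/2}` in the upper half-plane which is purely imaginary on the
real line and tends to zero along the imaginary axis vanishes. -/
theorem eq_zero_of_re_eq_zero {d : ℂ → ℂ} (hd : Differentiable ℂ d)
    (hre : ∀ x : ℝ, (d x).re = 0) {M : ℝ}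
    (hM : ∀ y : ℝ, 0 < y →
      starNorm (1 / 2) (fun x : ℝ => d (x + y * Complex.I)) ≤ ENNReal.ofReal M)
    (hlim : Tendsto (fun y : ℝ => d (y * Complex.I)) atTop (𝓝 0)) : d = 0 := by
  have hM' : ∀ y : ℝ, y ≠ 0 →
      starNorm (1 / 2) (fun x : ℝ => d (x + y * Complex.I)) ≤ ENNReal.ofReal |M| := by
    intro y hy
    have hMM := ENNReal.ofReal_le_ofReal (le_abs_self M)
    rcases lt_or_gt_of_ne hy with h | h
    · refine le_trans (le_of_eq ?_) ((hM (-y) (by linarith)).trans hMM)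
      unfold starNorm
      refine lintegral_congr fun x => ?_
      rw [← norm_conj_eq_of_re_eq_zero hd hre]
      simp
    · exact (hM y h).trans hMM
  -- Here `√|d c| ≤ 1 + 2(1 + (1 + |c|)²)|M| ≤ (1 + 4|M|)(1 + |c|)²`; squaring yields degree `4`.
  refine eq_zero_of_norm_le_one_add_pow hd (C := (1 + 4 * |M|) ^ 2) 4 (fun c => ?_) hlim
  have h1 := (sqrt_norm_le_lintegral hd c).trans (lintegral_ball_le hd.continuous hM' c)
  rw [← ENNReal.ofReal_mul (by positivity), ENNReal.ofReal_le_ofReal_iff (by positivity)] at h1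
  have h2 : √‖d c‖ ≤ (1 + 4 * |M|) * (1 + ‖c‖) ^ 2 := by
    have h3 := norm_nonneg c
    have h4 := abs_nonneg M
    nlinarith [mul_nonneg h4 h3, mul_nonneg h4 (mul_nonneg h3 h3)]
  calc ‖d c‖ = √‖d c‖ ^ 2 := (Real.sq_sqrt (norm_nonneg _)).symm
    _ ≤ ((1 + 4 * |M|) * (1 + ‖c‖) ^ 2) ^ 2 := pow_le_pow_left₀ (Real.sqrt_nonneg _) h2 2
    _ = _ := by ring

theorem Continuous.hasAngularLimit {h : ℂ → ℂ} (hh : Continuous h) (x : ℝ) :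
    HasAngularLimit h x (h x) :=
  fun _ _ => (hh.tendsto _).mono_left nhdsWithin_le_nhds

theorem eq_of_decomposes {f : ℝ → ℝ} {g h : ℂ → ℂ} (hg : Differentiable ℂ g)
    (hh : Differentiable ℂ h) (hgH : HardyClass (1 / 2) g) (hhH : HardyClass (1 / 2) h)
    (hgf : Decomposes f g fun x => g x) (hhf : Decomposes f h fun x => h x) : g = h := by
  obtain ⟨-, M₁, hM₁⟩ := hgH
  obtain ⟨-, M₂, hM₂⟩ := hhH
  have hd : Differentiable ℂ (fun z => g z - h z) := hg.sub hh
  have hre : ∀ x : ℝ, (g x - h x).re = 0 := by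
    have hae : (fun x : ℝ => (g x - h x).re) =ᵐ[volume] fun _ => 0 := by
      filter_upwards [hgf.2.1, hhf.2.1] with x hx hx'
      rw [hx, Complex.add_conj, Complex.add_conj, Complex.ofReal_inj] at hx'
      rw [Complex.sub_re]
      linarith
    have hc : Continuous fun x : ℝ => (g x - h x).re :=
      Complex.continuous_re.comp (hd.continuous.comp Complex.continuous_ofReal)
    exact congrFun ((hc.ae_eq_iff_eq volume continuous_const).1 hae)
  have hM : ∀ y : ℝ, 0 < y → starNorm (1 / 2) (fun x : ℝ =>
      g (x + y * Complex.I) - h (x + y * Complex.I)) ≤ ENNReal.ofReal (|M₁| + |M₂|) := by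
    intro y hy
    rw [ENNReal.ofReal_add (abs_nonneg _) (abs_nonneg _)]
    refine (starNorm_half_sub_le (hg.continuous.measurable.comp (by fun_prop))).trans ?_
    exact add_le_add ((hM₁ y hy).trans (ENNReal.ofReal_le_ofReal (le_abs_self _)))
      ((hM₂ y hy).trans (ENNReal.ofReal_le_ofReal (le_abs_self _)))
  have hlim := hgf.2.2.sub hhf.2.2
  rw [sub_zero] at hlim
  have h0 := eq_zero_of_re_eq_zero hd hre hM hlim
  ext z
  exact sub_eq_zero.1 (congrFun h0 z)

/-! ### Assembly -/

theorem hardyClass_cauchyTransform {f : ℝ → ℝ} (hf : Integrable f) :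
    HardyClass (1 / 2) (cauchyTransform f) :=
  ⟨differentiableOn_cauchyTransform hf, _, fun _ hy => starNorm_cauchyTransform_le hf hy⟩

theorem HardyClass.congr {p : ℝ} {g h : ℂ → ℂ} (hg : HardyClass p g)
    (heq : ∀ z : ℂ, 0 < z.im → h z = g z) : HardyClass p h := by
  obtain ⟨hd, M, hM⟩ := hg
  refine ⟨hd.congr heq, M, fun y hy => ?_⟩
  have : (fun x : ℝ => h (x + y * Complex.I)) = fun x : ℝ => g (x + y * Complex.I) := by
    ext x
    exact heq _ (by simpa using hy)
  rw [this]
  exact hM y hy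

theorem mainTheorem8 :
    ∃ C₁ C₂ : ℝ, ∀ f : ℝ → ℝ, Integrable f →
      (HardyClass (1 / 2) (cauchyTransform f) ∧
        ∃ hb : ℝ → ℂ, Decomposes f (cauchyTransform f) hb ∧
          starNorm (1 / 2) hb ≤ ENNReal.ofReal (C₁ * (∫ x : ℝ, |f x|) + C₂) ∧
          ∀ y : ℝ, 0 < y →
            starNorm (1 / 2) (fun x : ℝ => cauchyTransform f ((x : ℂ) + (y : ℂ) * Complex.I)) ≤
              ENNReal.ofReal (C₁ * (∫ x : ℝ, |f x|) + C₂)) ∧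
      ((∃ F : ℂ → ℂ, Differentiable ℂ F ∧ ∀ x : ℝ, F (x : ℂ) = (f x : ℂ)) →
        ∃ h : ℂ → ℂ,
          (Differentiable ℂ h ∧ HardyClass (1 / 2) h ∧ Decomposes f h (fun x : ℝ => h (x : ℂ))) ∧
          (∀ z : ℂ, 0 < z.im → h z = cauchyTransform f z) ∧
          ∀ g : ℂ → ℂ,
            (Differentiable ℂ g ∧ HardyClass (1 / 2) g ∧
              Decomposes f g (fun x : ℝ => g (x : ℂ))) → g = h) := by
  refine ⟨2 * √2 * Real.pi, 4 * √2 * Real.pi, fun f hf => ⟨⟨hardyClass_cauchyTransform hf, ?_⟩, ?_⟩⟩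
  -- The boundary function takes the value `0` on the null set where no angular limit exists.
  · have hex : ∀ x : ℝ, ∃ c : ℂ, (∃ c, HasAngularLimit (cauchyTransform f) x c) →
        HasAngularLimit (cauchyTransform f) x c := by
      intro x
      by_cases h : ∃ c, HasAngularLimit (cauchyTransform f) x c
      · exact ⟨h.choose, fun _ => h.choose_spec⟩
      · exact ⟨0, fun h' => absurd h' h⟩
    choose hb hhb using hex
    have hlim : ∀ᵐ x : ℝ, HasAngularLimit (cauchyTransform f) x (hb x) := by
      filter_upwards [ae_exists_hasAngularLimit_cauchyTransform hf] with x hx using hhb x hx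
    exact ⟨hb, ⟨hlim, eq_add_conj_of_ae_hasAngularLimit hf hlim, tendsto_cauchyTransform_mul_I hf⟩,
      starNorm_half_le_of_ae_hasAngularLimit (differentiableOn_cauchyTransform hf)
        (fun y hy => starNorm_cauchyTransform_le hf hy) hlim,
      fun y hy => starNorm_cauchyTransform_le hf hy⟩
  · rintro ⟨F, hF, hFf⟩
    obtain ⟨h, hh, heq⟩ := exists_differentiable_eq_cauchyTransform hf hF hFf
    have hH : HardyClass (1 / 2) h := (hardyClass_cauchyTransform hf).congr heq
    have hlim : ∀ x : ℝ, HasAngularLimit (cauchyTransform f) x (h x) := fun x =>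
      (hh.continuous.hasAngularLimit x).congr heq
    have hdec : Decomposes f h fun x => h x := by
      refine ⟨Eventually.of_forall hh.continuous.hasAngularLimit,
        eq_add_conj_of_ae_hasAngularLimit hf (Eventually.of_forall hlim), ?_⟩
      refine (tendsto_cauchyTransform_mul_I hf).congr' ?_
      filter_upwards [eventually_gt_atTop 0] with y hy
      exact (heq _ (by simpa using hy)).symm
    exact ⟨h, ⟨hh, hH, hdec⟩, heq, fun g hg => eq_of_decomposes hg.1 hh hg.2.1 hH hg.2.2 hdec⟩
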